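/- Let $p\ge 1$ be an integer and let $s>0$. For $t,M>0$ let $\mathcal H(t,M)$ be the set of probability densities $f$ on $\mathbb R^p$ (with respect to Lebesgue measure) that are $t$-Hölder with constant $M$: if $l$ is the largest non-negative integer strictly smaller than $t$, then all partial derivatives of $f$ up to order $l$ exist, and every partial derivative $\partial^\alpha f$ of order $l$ satisfies $|\partial^\alpha f(x)-\partial^\alpha f(y)|\le M\|x-y\|_2^{t-l}$ for all $x,y\in\mathbb R^p$. Let $L>0$, $0<s'\le s$, $L'>0$, $q\in[1,\infty]$ and $r\in[1,\infty)$. Let $W_{q,r}$ be the Wasserstein-$r$ distance induced by the $\ell_q$ norm on $\mathbb R^p$, that is, $W_{q,r}(\tilde f,f)=\inf (\mathbb E\|X'-X\|_q^r)^{1/r}$ over all couplings $(X',X)$ of the distributions with densities $\tilde f$ and $f$. For $x_0\in\mathbb R^p$, $n\ge1$ and $\varepsilon\in(0,1]$, the worst-case risk of an estimator $T:(\mathbb R^p)^n\to\mathbb R$ of $f(x_0)$ is $$R_{n,\varepsilon,x_0}(T)=\sup\ \mathbb E_{X_1',\dots,X_n'\sim\tilde f\ \text{i.i.d.}}\bigl(T(X_1',\dots,X_n')-f(x_0)\bigr)^2,$$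 the supremum being over all $f\in\mathcal H(s,L)$ and $\tilde f\in\mathcal H(s',L')$ with $W_{q,r}(\tilde f,f)\le\varepsilon$. The minimax risk is $\mathcal M_{n,\varepsilon,x_0}=\inf_T R_{n,\varepsilon,x_0}(T)$, the infimum being over all measurable $T$. Then there are constants $c,C>0$, depending only on $p,s,L,s',L',q,r$, such that for all $x_0\in\mathbb R^p$, $n\ge1$ and $\varepsilon\in(0,1]$, $$c\,\max\Bigl\{n^{-\frac{2s}{2s+p}},\ \varepsilon^{\frac{2s}{s+1+p/r}}\Bigr\}\ \le\ \mathcal M_{n,\varepsilon,x_0}\ \le\ C\,\max\Bigl\{n^{-\frac{2s}{2s+p}},\ \varepsilon^{\frac{2s}{s+1+p/r}}\Bigr\}.$$ Moreover, the upper bound is attained by a kernel density estimator. There is a bounded, infinitely differentiable, compactly supported kernel $K:\mathbb R^p\to\mathbb R$ with $\int K=1$, depending only on $p$ and $s$, such that for all $L,s',L',q,r$ as above and all $0<a\le b$ there is a constant $C'>0$, depending only on $p,s,L,s',L',q,r,a,b$, with the following property. For all $x_0\in\mathbb R^p$, $n\ge1$, $\varepsilon\in(0,1]$ and every bandwidth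 $h$ with $a h^\star\le h\le b h^\star$, where $h^\star=\max\{n^{-1/(2s+p)},\varepsilon^{1/(s+1+p/r)}\}$, the estimator $$\hat f_h(x_0)=\frac1{n h^p}\sum_{i=1}^n K\Bigl(\frac{X_i'-x_0}{h}\Bigr)$$ satisfies $R_{n,\varepsilon,x_0}(\hat f_h(x_0))\le C'\max\{n^{-\frac{2s}{2s+p}},\varepsilon^{\frac{2s}{s+1+p/r}}\}$. -/

import Mathlib

open MeasureTheory
open scoped ENNReal ContDiff

noncomputable section

namespace WassersteinDensity

/-- `ℝ^p` with its Euclidean norm. -/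
abbrev E (p : ℕ) : Type := EuclideanSpace ℝ (Fin p)

/-- The `ℓ_q` norm of a vector of `ℝ^p`, for `q ∈ [1, ∞]`. -/
def ellNorm {p : ℕ} (q : ℝ≥0∞) (x : E p) : ℝ :=
  ‖(WithLp.toLp q (fun i => x i) : PiLp q (fun _ : Fin p => ℝ))‖

/-- `π` is a coupling of `μ` and `ν`. -/
def IsCoupling {p : ℕ} (π : Measure (E p × E p)) (μ ν : Measure (E p)) : Prop :=
  π.map Prod.fst = μ ∧ π.map Prod.snd = ν

/-- The Wasserstein-`r` distance induced by the `ℓ_q` norm (`∞` if no coupling has finite cost). -/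
def wasserstein {p : ℕ} (q : ℝ≥0∞) (r : ℝ) (μ ν : Measure (E p)) : ℝ≥0∞ :=
  (⨅ (π : Measure (E p × E p)) (_ : IsCoupling π μ ν),
    ∫⁻ z, ENNReal.ofReal (ellNorm q (z.1 - z.2) ^ r) ∂π) ^ (1 / r)

/-- `f` is a probability density on `ℝ^p` (with respect to Lebesgue measure). -/
def IsDensity {p : ℕ} (f : E p → ℝ) : Prop :=
  (∀ x, 0 ≤ f x) ∧ Integrable f ∧ ∫ x, f x = 1

/-- The measure on `ℝ^p` with Lebesgue density `f`. -/
def law {p : ℕ} (f : E p → ℝ) : Measure (E p) :=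
  volume.withDensity (fun x => ENNReal.ofReal (f x))

/-- The largest non-negative integer strictly smaller than `s`, for `s > 0`. -/
def holderOrder (s : ℝ) : ℕ := ⌈s⌉₊ - 1

/-- The partial derivative of order `l` of `f` at `x` in the coordinate directions
`j 0, …, j (l - 1)`. -/
def partialDeriv {p l : ℕ} (f : E p → ℝ) (j : Fin l → Fin p) (x : E p) : ℝ :=
  iteratedFDeriv ℝ l f x (fun i => EuclideanSpace.single (j i) (1 : ℝ))

/-- `s`-Hölder smoothness with constant `L`: with `l` the largest integer strictly smaller than
`s`, the partial derivatives up to order `l` exist, and those of order `l` satisfy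
`|∂^j f(x) - ∂^j f(y)| ≤ L ‖x - y‖₂ ^ (s - l)`. (The Hölder condition makes the derivatives of
order `l` continuous, so that existence amounts to `f` being `l` times continuously
differentiable.) -/
def IsHolder {p : ℕ} (s L : ℝ) (f : E p → ℝ) : Prop :=
  ContDiff ℝ (holderOrder s : ℕ) f ∧
    ∀ (j : Fin (holderOrder s) → Fin p) (x y : E p),
      |partialDeriv f j x - partialDeriv f j y| ≤ L * ‖x - y‖ ^ (s - (holderOrder s : ℝ))

/-- The pairs of a true density `f`, which is `s`-Hölder with constant `L`, and a contaminated
density `g`, which is `s'`-Hölder with constant `L'`, at Wasserstein distance at most `ε`. -/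
def Admissible {p : ℕ} (s L s' L' : ℝ) (q : ℝ≥0∞) (r ε : ℝ) (f g : E p → ℝ) : Prop :=
  IsDensity f ∧ IsHolder s L f ∧ IsDensity g ∧ IsHolder s' L' g ∧
    wasserstein q r (law g) (law f) ≤ ENNReal.ofReal ε

/-- The squared risk `𝔼 (T(X'₁, …, X'ₙ) - f(x₀))²`, for `X'₁, …, X'ₙ` i.i.d. with density `g`. -/
def risk {p n : ℕ} (x₀ : E p) (T : (Fin n → E p) → ℝ) (f g : E p → ℝ) : ℝ≥0∞ :=
  ∫⁻ X, ENNReal.ofReal ((T X - f x₀) ^ 2) ∂(Measure.pi (fun _ : Fin n => law g))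

/-- The worst-case risk of the estimator `T` of `f(x₀)`. -/
def worstRisk {p n : ℕ} (s L s' L' : ℝ) (q : ℝ≥0∞) (r ε : ℝ) (x₀ : E p)
    (T : (Fin n → E p) → ℝ) : ℝ≥0∞ :=
  ⨆ (f : E p → ℝ) (g : E p → ℝ) (_ : Admissible s L s' L' q r ε f g), risk x₀ T f g

/-- The minimax risk over all (measurable) estimators of `f(x₀)` from `n` contaminated data. -/
def minimaxRisk {p : ℕ} (n : ℕ) (s L s' L' : ℝ) (q : ℝ≥0∞) (r ε : ℝ) (x₀ : E p) : ℝ≥0∞ :=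
  ⨅ (T : (Fin n → E p) → ℝ) (_ : Measurable T), worstRisk s L s' L' q r ε x₀ T

/-- The kernel density estimator at `x₀` with kernel `K` and bandwidth `h`. -/
def kde {p n : ℕ} (K : E p → ℝ) (h : ℝ) (x₀ : E p) (X : Fin n → E p) : ℝ :=
  (1 / ((n : ℝ) * h ^ p)) * ∑ i, K ((1 / h) • (X i - x₀))

/-- The rate `max {n ^ (-2s/(2s+p)), ε ^ (2s/(s+1+p/r))}`. -/
def rate (p n : ℕ) (s r ε : ℝ) : ℝ :=
  max ((n : ℝ) ^ (-(2 * s) / (2 * s + (p : ℝ)))) (ε ^ ((2 * s) / (s + 1 + (p : ℝ) / r)))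

/-- The bandwidth `max {n ^ (-1/(2s+p)), ε ^ (1/(s+1+p/r))}`. -/
def bandwidth (p n : ℕ) (s r ε : ℝ) : ℝ :=
  max ((n : ℝ) ^ (-1 / (2 * s + (p : ℝ)))) (ε ^ (1 / (s + 1 + (p : ℝ) / r)))

end WassersteinDensity

end

open WassersteinDensity

/-! Upper bound. The kernel estimator is a sample mean, so its risk is at most a variance term plus
a squared bias (`lintegral_linear_statistic_le`). Hölder densities are uniformly bounded
(`exists_density_le`), so a ball of radius of order `h` has mass `O(h^p)` under both laws, and the
variance is `O(1/(n h^p))`. The bias splits into a smoothing error `O(h^s)` (`exists_bias_le`) and a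
contamination error. For the latter, take a nearly optimal coupling: the rescaled kernel is
`O(1/h)`-Lipschitz, and its increment vanishes unless one of the two coupled points lies in its
support, an event of probability `O(h^p)`. Hölder's inequality on that event bounds the expected
displacement by a multiple of `ε h^(p(1-1/r))`; with the factors `1/h` and `h^(-p)` the error is
`O(ε h^(-(1+p/r)))` (`abs_integral_sub_integral_le`). The bandwidth of the theorem balances the
three terms.

Lower bound. Start from a density `f` that is constant near `x₀`, and let `g = f z` with `z = 1 + κ
∂ᵢw((x-x₀)/h)`, where `w` is a compactly supported bump and `κ` is of order `h^s`. Then `g` stays in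
the Hölder classes and differs from `f` at `x₀` by order `h^s`. The factor `z` is exactly the
Jacobian of the shear `x ↦ x + κ h w((x-x₀)/h) eᵢ`, so this shear pushes `g` forward to `f`
(`map_transport_law`). It moves points by `O(h^(s+1))`, and only in a ball of mass `O(h^p)`; hence
the Wasserstein distance is at most `h^(s+1+p/r)`, once the constant in `κ` is small. The chi-square
divergence is `O(h^(2s+p))`. All this is in `exists_density_pair`.

The pair is used twice with Le Cam's `two_point_bound`. For `h = n^(-1/(2s+p))` the data are
uncontaminated and `n` observations cannot tell `f` from `g`. For `h = ε^(1/(s+1+p/r))` the data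
have density `f` whichever of `f` and `g` is true, so no sample size helps. -/

namespace WassersteinDensity

variable {p : ℕ}

/-! ### Hölder classes: scaling, smooth bumps, restriction to lines -/

section Holder

lemma holderOrder_lt {s : ℝ} (hs : 0 < s) : (holderOrder s : ℝ) < s := by
  have h1 : 0 < ⌈s⌉₊ := Nat.ceil_pos.2 hs
  have h2 := Nat.ceil_lt_add_one hs.le
  have h3 : (holderOrder s : ℝ) = (⌈s⌉₊ : ℝ) - 1 := by
    rw [holderOrder, Nat.cast_sub h1]; simp
  linarith

lemma sub_holderOrder_le_one {s : ℝ} (hs : 0 < s) : s - holderOrder s ≤ 1 := by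
  have h1 : 0 < ⌈s⌉₊ := Nat.ceil_pos.2 hs
  have h2 := Nat.le_ceil s
  have h3 : (holderOrder s : ℝ) = (⌈s⌉₊ : ℝ) - 1 := by
    rw [holderOrder, Nat.cast_sub h1]; simp
  linarith

lemma partialDeriv_add {l : ℕ} {f g : E p → ℝ} (hf : ContDiff ℝ l f) (hg : ContDiff ℝ l g)
    (j : Fin l → Fin p) (x : E p) :
    partialDeriv (fun y => f y + g y) j x = partialDeriv f j x + partialDeriv g j x := by
  unfold partialDeriv
  rw [show (fun y => f y + g y) = f + g from rfl,
    iteratedFDeriv_add_apply hf.contDiffAt hg.contDiffAt]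
  rfl

lemma partialDeriv_scale {l : ℕ} {F : E p → ℝ} (hF : ContDiff ℝ l F) (a c : ℝ) (x₀ : E p)
    (j : Fin l → Fin p) (x : E p) :
    partialDeriv (fun y => a * F (c • (y - x₀))) j x
      = a * c ^ l * partialDeriv F j (c • (x - x₀)) := by
  unfold partialDeriv
  have hG : ContDiff ℝ l (F ∘ (c • ContinuousLinearMap.id ℝ (E p))) :=
    hF.comp (ContinuousLinearMap.contDiff _)
  have h0 : (fun y => a * F (c • (y - x₀)))
      = a • (fun y => (F ∘ (c • ContinuousLinearMap.id ℝ (E p))) (y - x₀)) := by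
    ext y; simp
  have hG' : ContDiff ℝ l (fun y => (F ∘ (c • ContinuousLinearMap.id ℝ (E p))) (y - x₀)) :=
    hG.comp (contDiff_id.sub contDiff_const)
  rw [h0, iteratedFDeriv_const_smul_apply hG'.contDiffAt, iteratedFDeriv_comp_sub,
    ContinuousLinearMap.iteratedFDeriv_comp_right _ hF _ le_rfl]
  simp [ContinuousMultilinearMap.map_smul_univ, mul_assoc]

lemma IsHolder.add {s L M : ℝ} {f g : E p → ℝ} (hf : IsHolder s L f) (hg : IsHolder s M g) :
    IsHolder s (L + M) (fun x => f x + g x) := by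
  refine ⟨hf.1.add hg.1, fun j x y => ?_⟩
  rw [partialDeriv_add hf.1 hg.1, partialDeriv_add hf.1 hg.1, add_mul]
  refine le_trans ?_ (add_le_add (hf.2 j x y) (hg.2 j x y))
  rw [add_sub_add_comm]
  exact abs_add_le _ _

lemma IsHolder.mono {s L M : ℝ} {f : E p → ℝ} (hf : IsHolder s L f) (h : L ≤ M) :
    IsHolder s M f :=
  ⟨hf.1, fun j x y => (hf.2 j x y).trans (by gcongr)⟩

/-- By the chain rule the derivatives of order `l` gain `h^(-l)`, and the Hölder quotient of
exponent `s - l` gains `h^(-(s-l))`: in total `h^(-s)`. -/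
lemma IsHolder.scale {s M : ℝ} {F : E p → ℝ} (hF : IsHolder s M F) (a : ℝ)
    {h : ℝ} (hh : 0 < h) (x₀ : E p) :
    IsHolder s (|a| * h ^ (-s) * M) (fun x => a * F (h⁻¹ • (x - x₀))) := by
  refine ⟨contDiff_const.mul (hF.1.comp ((contDiff_id.sub contDiff_const).const_smul _)),
    fun j x y => ?_⟩
  rw [partialDeriv_scale hF.1, partialDeriv_scale hF.1, ← mul_sub, abs_mul, abs_mul]
  have h1 := hF.2 j (h⁻¹ • (x - x₀)) (h⁻¹ • (y - x₀))
  rw [← smul_sub, sub_sub_sub_cancel_right, norm_smul, Real.norm_eq_abs,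
    abs_of_pos (inv_pos.2 hh), Real.mul_rpow (by positivity) (by positivity)] at h1
  have h2 : h⁻¹ ^ holderOrder s * h⁻¹ ^ (s - holderOrder s) = h ^ (-s) := by
    rw [← Real.rpow_natCast, ← Real.rpow_add (inv_pos.2 hh), Real.inv_rpow hh.le,
      Real.rpow_neg hh.le]
    congr 2; ring
  rw [abs_of_pos (pow_pos (inv_pos.2 hh) _), ← h2]
  calc _ ≤ |a| * h⁻¹ ^ holderOrder s
        * (M * (h⁻¹ ^ (s - holderOrder s) * ‖x - y‖ ^ (s - holderOrder s))) := by gcongr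
    _ = _ := by ring

/-- The derivative of order `l` is Lipschitz and bounded. As `0 < s - l ≤ 1`, the Lipschitz bound
serves at distances at most `1` and the sup bound at larger ones. -/
lemma exists_isHolder_of_hasCompactSupport {F : E p → ℝ} (hF : ContDiff ℝ ∞ F)
    (hc : HasCompactSupport F) {s : ℝ} (hs : 0 < s) : ∃ M, 0 < M ∧ IsHolder s M F := by
  set l := holderOrder s
  have hD : ContDiff ℝ 1 (iteratedFDeriv ℝ l F) :=
    hF.iteratedFDeriv_right (by exact_mod_cast le_top)
  have hDc : HasCompactSupport (iteratedFDeriv ℝ l F) := hc.iteratedFDeriv l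
  obtain ⟨A, hA⟩ := hD.lipschitzWith_of_hasCompactSupport hDc one_ne_zero
  obtain ⟨B, hB⟩ := hDc.exists_bound_of_continuous hD.continuous
  have hB0 : 0 ≤ B := (norm_nonneg _).trans (hB 0)
  refine ⟨A + 2 * B + 1, by positivity, hF.of_le (by exact_mod_cast le_top), fun j x y => ?_⟩
  have h1 : |partialDeriv F j x - partialDeriv F j y|
      ≤ ‖iteratedFDeriv ℝ l F x - iteratedFDeriv ℝ l F y‖ := by
    have := (iteratedFDeriv ℝ l F x - iteratedFDeriv ℝ l F y).le_opNorm
      (fun i => EuclideanSpace.single (j i) (1 : ℝ))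
    simpa [partialDeriv] using this
  have he1 : 0 < s - l := sub_pos.2 (holderOrder_lt hs)
  have he2 : s - l ≤ 1 := sub_holderOrder_le_one hs
  rcases le_total ‖x - y‖ 1 with hxy | hxy
  · have h2 := hA.norm_sub_le x y
    have h3 : ‖x - y‖ ≤ ‖x - y‖ ^ (s - l) := by
      rcases eq_or_ne ‖x - y‖ 0 with h0 | h0
      · rw [h0]; positivity
      · simpa using Real.rpow_le_rpow_of_exponent_ge
          (lt_of_le_of_ne (norm_nonneg _) h0.symm) hxy he2
    calc _ ≤ A * ‖x - y‖ := h1.trans h2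
      _ ≤ (A + 2 * B + 1) * ‖x - y‖ ^ (s - l) := by gcongr; linarith
  · have h2 : 1 ≤ ‖x - y‖ ^ (s - l) := Real.one_le_rpow hxy he1.le
    calc _ ≤ B + B := h1.trans ((norm_sub_le _ _).trans (add_le_add (hB x) (hB y)))
      _ ≤ (A + 2 * B + 1) * 1 := by have := A.2; linarith
      _ ≤ _ := by gcongr

lemma iteratedDeriv_line {l : ℕ} {f : E p → ℝ} (hf : ContDiff ℝ l f) (x v : E p) (t : ℝ) :
    iteratedDeriv l (fun t : ℝ => f (x + t • v)) t
      = iteratedFDeriv ℝ l f (x + t • v) fun _ => v := by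
  rw [iteratedDeriv_eq_iteratedFDeriv]
  have h0 : (fun t : ℝ => f (x + t • v))
      = (fun y => f (x + y)) ∘ (ContinuousLinearMap.toSpanSingleton ℝ v) := by
    ext t; simp
  have hG : ContDiff ℝ l (fun y => f (x + y)) := hf.comp (contDiff_const.add contDiff_id)
  rw [h0, ContinuousLinearMap.iteratedFDeriv_comp_right _ hG _ le_rfl]
  simp only [ContinuousMultilinearMap.compContinuousLinearMap_apply, iteratedFDeriv_comp_add_left]
  simp

/-- Multilinear expansion in the standard basis. The Hölder condition concerns coordinate partial
derivatives only; this carries it to an arbitrary direction, at the price of `p^l` terms. -/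
lemma iteratedFDeriv_diag {l : ℕ} (f : E p → ℝ) (x v : E p) :
    (iteratedFDeriv ℝ l f x fun _ => v)
      = ∑ j : Fin l → Fin p, (∏ i, v (j i)) * partialDeriv f j x := by
  have hv : v = ∑ k, v k • EuclideanSpace.single k (1 : ℝ) := by
    simpa using (EuclideanSpace.basisFun (Fin p) ℝ).sum_repr v |>.symm
  calc _ = iteratedFDeriv ℝ l f x (fun _ => ∑ k, v k • EuclideanSpace.single k (1 : ℝ)) := by
        rw [← hv]
    _ = _ := by
        rw [ContinuousMultilinearMap.map_sum]
        refine Finset.sum_congr rfl fun j _ => ?_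
        rw [ContinuousMultilinearMap.map_smul_univ]
        rfl

/-- A Hölder function is Hölder along every line. -/
lemma IsHolder.line {s L : ℝ} {f : E p → ℝ} (hf : IsHolder s L f) (hs : 0 < s)
    (x v : E p) {t : ℝ} (ht : 0 ≤ t) :
    |iteratedDeriv (holderOrder s) (fun t : ℝ => f (x + t • v)) t
        - iteratedDeriv (holderOrder s) (fun t : ℝ => f (x + t • v)) 0|
      ≤ (p : ℝ) ^ holderOrder s * L * ‖v‖ ^ s * t ^ (s - holderOrder s) := by
  rw [iteratedDeriv_line hf.1, iteratedDeriv_line hf.1, iteratedFDeriv_diag, iteratedFDeriv_diag,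
    ← Finset.sum_sub_distrib]
  set l := holderOrder s
  have hl : (l : ℝ) < s := holderOrder_lt hs
  calc _ ≤ ∑ j : Fin l → Fin p, |(∏ i, v (j i)) * partialDeriv f j (x + t • v)
        - (∏ i, v (j i)) * partialDeriv f j (x + (0 : ℝ) • v)| := Finset.abs_sum_le_sum_abs _ _
    _ ≤ ∑ j : Fin l → Fin p, ‖v‖ ^ l * (L * (t * ‖v‖) ^ (s - l)) := by
        refine Finset.sum_le_sum fun j _ => ?_
        rw [← mul_sub, abs_mul, Finset.abs_prod]
        have h1 := hf.2 j (x + t • v) (x + (0 : ℝ) • v)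
        have h2 : ‖x + t • v - (x + (0 : ℝ) • v)‖ = t * ‖v‖ := by
          simp [norm_smul, abs_of_nonneg ht]
        rw [h2] at h1
        refine mul_le_mul ?_ h1 (abs_nonneg _) (by positivity)
        calc _ ≤ ∏ _i : Fin l, ‖v‖ :=
              Finset.prod_le_prod (fun _ _ => abs_nonneg _) fun i _ => PiLp.norm_apply_le v (j i)
          _ = _ := by simp
    _ = _ := by
        rw [Finset.sum_const, Finset.card_univ, Fintype.card_fun, Fintype.card_fin,
          Fintype.card_fin, nsmul_eq_mul, Real.mul_rpow ht (norm_nonneg _)]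
        rcases eq_or_ne ‖v‖ 0 with h0 | h0
        · rw [h0, Real.zero_rpow (by linarith), Real.zero_rpow hs.ne']; ring
        · have : ‖v‖ ^ s = ‖v‖ ^ l * ‖v‖ ^ (s - l) := by
            rw [← Real.rpow_natCast, ← Real.rpow_add (lt_of_le_of_ne (norm_nonneg _) h0.symm)]
            congr 1; ring
          rw [this]; push_cast; ring

end Holder

/-! ### Polynomial extrapolation to the origin -/

section Extrapolation

/-- Weights which extrapolate polynomials of degree at most `l` from `1, …, l + 1` to `0`. -/
noncomputable def extrapolationWeight (l j : ℕ) : ℝ :=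
  (Lagrange.basis (Finset.range (l + 1)) (fun i : ℕ => (i : ℝ) + 1) j).eval 0

/-- Lagrange interpolation at `l + 1` distinct nodes reproduces polynomials of degree at most `l`;
evaluate at `0`. -/
lemma sum_extrapolationWeight_mul_eval (l : ℕ) (P : Polynomial ℝ) (hP : P.degree < (l + 1 : ℕ)) :
    ∑ j ∈ Finset.range (l + 1), extrapolationWeight l j * P.eval ((j : ℝ) + 1) = P.eval 0 := by
  have hinj : Set.InjOn (fun i : ℕ => (i : ℝ) + 1) (Finset.range (l + 1) : Finset ℕ) := by
    intro a _ b _ h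
    simpa using h
  have h := Lagrange.eq_interpolate (f := P) hinj (by simpa using hP)
  conv_rhs => rw [h, Lagrange.interpolate_apply, Polynomial.eval_finsetSum]
  exact Finset.sum_congr rfl fun j _ => by
    simp [extrapolationWeight, mul_comm]

lemma sum_extrapolationWeight (l : ℕ) :
    ∑ j ∈ Finset.range (l + 1), extrapolationWeight l j = 1 := by
  simpa using sum_extrapolationWeight_mul_eval l 1
    (by rw [Polynomial.degree_one]; exact_mod_cast Nat.succ_pos l)

/-- The polynomial is the Taylor polynomial of degree `l` at `0`. Order zero is treated apart, since
there the hypothesis is already the claim. -/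
lemma exists_polynomial_near {s : ℝ} (hs : 0 < s) {M : ℝ} (hM : 0 ≤ M) {F : ℝ → ℝ}
    (hF : ContDiff ℝ (holderOrder s : ℕ) F)
    (h : ∀ t, 0 ≤ t → |iteratedDeriv (holderOrder s) F t - iteratedDeriv (holderOrder s) F 0|
      ≤ M * t ^ (s - holderOrder s)) :
    ∃ P : Polynomial ℝ, P.degree < (holderOrder s + 1 : ℕ) ∧ P.eval 0 = F 0 ∧
      ∀ t, 0 < t → |F t - P.eval t| ≤ M * t ^ s := by
  have hl := holderOrder_lt hs
  generalize holderOrder s = l at *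
  rcases l with _ | n
  · refine ⟨Polynomial.C (F 0), ?_, by simp, fun t ht => ?_⟩
    · exact Polynomial.degree_C_le.trans_lt (by simp)
    · simpa using h t ht.le
  · refine ⟨∑ k ∈ Finset.range (n + 2),
      Polynomial.C ((k.factorial : ℝ)⁻¹ * iteratedDeriv k F 0) * Polynomial.X ^ k, ?_, ?_, ?_⟩
    · refine (Polynomial.degree_sum_le _ _).trans_lt ?_
      rw [Finset.sup_lt_iff (by exact_mod_cast WithBot.bot_lt_coe (n + 1 + 1))]
      intro k hk
      refine (Polynomial.degree_C_mul_X_pow_le _ _).trans_lt ?_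
      exact_mod_cast Finset.mem_range.1 hk
    · rw [Polynomial.eval_finsetSum, Finset.sum_eq_single 0]
      · simp
      · intro k _ hk; simp [hk]
      · simp
    · intro t ht
      -- Expand only to degree `n`. The Lagrange remainder has the derivative of order `n + 1` at
      -- some `u < t`; subtracting the top Taylor term compares it with its value at `0`, which the
      -- Hölder bound controls.
      obtain ⟨u, hu, hT⟩ := taylor_mean_remainder_lagrange_iteratedDeriv (f := F) (n := n) ht.ne
        (by exact_mod_cast hF.contDiffOn)
      rw [Set.uIoo_of_lt ht] at hu
      have hpoly : taylorWithinEval F n (Set.uIcc 0 t) 0 t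
          = ∑ k ∈ Finset.range (n + 1), (k.factorial : ℝ)⁻¹ * iteratedDeriv k F 0 * t ^ k := by
        rw [taylor_within_apply]
        refine Finset.sum_congr rfl fun k hk => ?_
        rw [iteratedDerivWithin_eq_iteratedDeriv (uniqueDiffOn_uIcc ht.ne)
          ((hF.of_le (by exact_mod_cast (Finset.mem_range.1 hk).le)).contDiffAt) Set.left_mem_uIcc]
        simp; ring
      rw [Polynomial.eval_finsetSum, Finset.sum_range_succ]
      simp only [Polynomial.eval_mul, Polynomial.eval_C, Polynomial.eval_pow, Polynomial.eval_X]
      rw [← hpoly, ← sub_sub, hT, sub_zero]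
      have h1 := h u hu.1.le
      have h2 : iteratedDeriv (n + 1) F u * t ^ (n + 1) / ((n + 1).factorial : ℝ)
          - ((n + 1).factorial : ℝ)⁻¹ * iteratedDeriv (n + 1) F 0 * t ^ (n + 1)
          = (iteratedDeriv (n + 1) F u - iteratedDeriv (n + 1) F 0) * t ^ (n + 1)
            * ((n + 1).factorial : ℝ)⁻¹ := by ring
      rw [h2, abs_mul, abs_mul, abs_of_pos (pow_pos ht _),
        abs_of_pos (inv_pos.2 (by positivity : (0 : ℝ) < ((n + 1).factorial : ℝ)))]
      have h3 : t ^ s = t ^ (s - (n + 1 : ℕ)) * t ^ (n + 1) := by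
        rw [← Real.rpow_natCast, ← Real.rpow_add ht]; congr 1; ring
      have h4 : ((n + 1).factorial : ℝ)⁻¹ ≤ 1 :=
        inv_le_one_of_one_le₀ (by exact_mod_cast Nat.succ_le_of_lt (Nat.factorial_pos _))
      have h5 : u ^ (s - (n + 1 : ℕ)) ≤ t ^ (s - (n + 1 : ℕ)) :=
        Real.rpow_le_rpow hu.1.le hu.2.le (by linarith)
      calc _ ≤ (M * t ^ (s - (n + 1 : ℕ))) * t ^ (n + 1) * 1 := by
            gcongr
            exact h1.trans (by gcongr)
        _ = M * t ^ s := by rw [h3]; ring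

/-- Extrapolation to `0` of a function with Hölder derivative. -/
lemma abs_sum_extrapolationWeight_sub_le {s : ℝ} (hs : 0 < s) {M : ℝ} (hM : 0 ≤ M) {F : ℝ → ℝ}
    (hF : ContDiff ℝ (holderOrder s : ℕ) F)
    (h : ∀ t, 0 ≤ t → |iteratedDeriv (holderOrder s) F t - iteratedDeriv (holderOrder s) F 0|
      ≤ M * t ^ (s - holderOrder s)) :
    |∑ j ∈ Finset.range (holderOrder s + 1),
        extrapolationWeight (holderOrder s) j * F ((j : ℝ) + 1) - F 0|
      ≤ (∑ j ∈ Finset.range (holderOrder s + 1),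
        |extrapolationWeight (holderOrder s) j| * ((j : ℝ) + 1) ^ s) * M := by
  obtain ⟨P, hP, hP0, hPt⟩ := exists_polynomial_near hs hM hF h
  rw [← hP0, ← sum_extrapolationWeight_mul_eval _ P hP, ← Finset.sum_sub_distrib, Finset.sum_mul]
  refine (Finset.abs_sum_le_sum_abs _ _).trans (Finset.sum_le_sum fun j _ => ?_)
  rw [← mul_sub, abs_mul, mul_assoc]
  gcongr
  rw [mul_comm]
  exact hPt _ (by positivity)

end Extrapolation

end WassersteinDensity

namespace WassersteinDensity

variable {p : ℕ}

/-! ### The higher-order kernel, its bias, and a uniform bound on Hölder densities -/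

section Kernel

/-- A smooth bump supported in the ball of radius `2`. -/
noncomputable def bump (p : ℕ) : ContDiffBump (0 : E p) := ⟨1, 2, one_pos, one_lt_two⟩

/-- A smooth probability density supported in the ball of radius `2`. -/
noncomputable def mollifier (p : ℕ) : E p → ℝ := (bump p).normed volume

lemma mollifier_nonneg (x : E p) : 0 ≤ mollifier p x := (bump p).nonneg_normed x

lemma contDiff_mollifier : ContDiff ℝ ∞ (mollifier p) := (bump p).contDiff_normed

lemma hasCompactSupport_mollifier : HasCompactSupport (mollifier p) :=
  (bump p).hasCompactSupport_normed

lemma integral_mollifier : ∫ x, mollifier p x = 1 := (bump p).integral_normed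

lemma mollifier_eq_zero {x : E p} (hx : 2 ≤ ‖x‖) : mollifier p x = 0 := by
  by_contra h
  have : x ∈ Function.support (mollifier p) := h
  rw [mollifier, ContDiffBump.support_normed_eq, mem_ball_zero_iff] at this
  exact absurd this (not_lt.2 hx)

lemma integrable_mollifier : Integrable (mollifier p) := (bump p).integrable_normed

/-- A smooth compactly supported kernel of order `l`. -/
noncomputable def higherOrderKernel (p l : ℕ) (x : E p) : ℝ :=
  ∑ j ∈ Finset.range (l + 1), extrapolationWeight l j *
    ((((j : ℝ) + 1) ^ p)⁻¹ * mollifier p (((j : ℝ) + 1)⁻¹ • x))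

lemma contDiff_higherOrderKernel (l : ℕ) : ContDiff ℝ ∞ (higherOrderKernel p l) := by
  unfold higherOrderKernel
  refine ContDiff.sum fun j _ => contDiff_const.mul (contDiff_const.mul ?_)
  exact contDiff_mollifier.comp (contDiff_id.const_smul _)

lemma higherOrderKernel_eq_zero (l : ℕ) {x : E p} (hx : 2 * ((l : ℝ) + 1) ≤ ‖x‖) :
    higherOrderKernel p l x = 0 := by
  refine Finset.sum_eq_zero fun j hj => ?_
  rw [mollifier_eq_zero]
  · simp
  · have hj' : (j : ℝ) ≤ l := by exact_mod_cast Nat.lt_succ_iff.1 (Finset.mem_range.1 hj)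
    have h1 : (0 : ℝ) < (j : ℝ) + 1 := by positivity
    rw [norm_smul, Real.norm_eq_abs, abs_of_pos (inv_pos.2 h1), inv_mul_eq_div, le_div_iff₀ h1]
    linarith

lemma hasCompactSupport_higherOrderKernel (l : ℕ) :
    HasCompactSupport (higherOrderKernel p l) := by
  refine HasCompactSupport.intro (isCompact_closedBall 0 (2 * ((l : ℝ) + 1))) fun x hx => ?_
  exact higherOrderKernel_eq_zero l (by simpa using (not_le.1 fun h => hx (by simpa using h)).le)

lemma exists_abs_higherOrderKernel_le (p l : ℕ) :
    ∃ B, 0 ≤ B ∧ ∀ x, |higherOrderKernel p l x| ≤ B := by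
  obtain ⟨B, hB⟩ := (hasCompactSupport_higherOrderKernel (p := p) l).exists_bound_of_continuous
    (contDiff_higherOrderKernel l).continuous
  exact ⟨B, (norm_nonneg _).trans (hB 0), hB⟩

lemma integral_rescale_mul (φ f : E p → ℝ) {c : ℝ} (hc : 0 < c) (x₀ : E p) :
    ∫ x, (c ^ p)⁻¹ * φ (c⁻¹ • (x - x₀)) * f x = ∫ u, φ u * f (x₀ + c • u) := by
  have h1 : (fun x => (c ^ p)⁻¹ * φ (c⁻¹ • (x - x₀)) * f x)
      = fun x => (fun y => (c ^ p)⁻¹ * (φ (c⁻¹ • y) * f (x₀ + c • (c⁻¹ • y)))) (x - x₀) := by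
    ext x
    simp only [smul_inv_smul₀ hc.ne', add_sub_cancel]
    ring
  rw [h1, integral_sub_right_eq_self (fun y => (c ^ p)⁻¹ * (φ (c⁻¹ • y) * f (x₀ + c • (c⁻¹ • y)))),
    integral_const_mul,
    Measure.integral_comp_inv_smul_of_nonneg volume (fun u => φ u * f (x₀ + c • u)) hc.le]
  simp [hc.ne']

lemma integrable_mollifier_mul {f : E p → ℝ} (hf : Continuous f) :
    Integrable fun u => mollifier p u * f u :=
  (contDiff_mollifier.continuous.mul hf).integrable_of_hasCompactSupport
    hasCompactSupport_mollifier.mul_right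

/-- Rescaling each summand of the kernel turns smoothing into an average, over directions `u`, of
the extrapolation to `t = 0` of `t ↦ f(x₀ + t h u)` from `t = 1, …, l + 1`. This replaces
vanishing-moment conditions on the kernel. -/
lemma integral_higherOrderKernel_mul (l : ℕ) {f : E p → ℝ} (hf : Continuous f) {h : ℝ}
    (hh : 0 < h) (x₀ : E p) :
    ∫ x, (h ^ p)⁻¹ * higherOrderKernel p l (h⁻¹ • (x - x₀)) * f x
      = ∫ u, mollifier p u * ∑ j ∈ Finset.range (l + 1),
          extrapolationWeight l j * f (x₀ + ((j : ℝ) + 1) • (h • u)) := by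
  have hj : ∀ j : ℕ, Integrable fun u =>
      mollifier p u * (extrapolationWeight l j * f (x₀ + ((j : ℝ) + 1) • (h • u))) := fun j =>
    integrable_mollifier_mul (by fun_prop)
  simp_rw [Finset.mul_sum]
  rw [integral_finsetSum _ fun j _ => hj j]
  have hφ : Continuous (mollifier p) := contDiff_mollifier.continuous
  have hc : ∀ j : ℕ, (0 : ℝ) < ((j : ℝ) + 1) * h := fun j => by positivity
  have h2 : ∀ x, (h ^ p)⁻¹ * higherOrderKernel p l (h⁻¹ • (x - x₀)) * f x
      = ∑ j ∈ Finset.range (l + 1), extrapolationWeight l j *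
        (((((j : ℝ) + 1) * h) ^ p)⁻¹ * mollifier p ((((j : ℝ) + 1) * h)⁻¹ • (x - x₀)) * f x) := by
    intro x
    rw [higherOrderKernel, Finset.mul_sum, Finset.sum_mul]
    refine Finset.sum_congr rfl fun j _ => ?_
    rw [smul_smul, mul_inv, mul_pow, mul_inv]; ring
  simp_rw [h2]
  rw [integral_finsetSum]
  · refine Finset.sum_congr rfl fun j _ => ?_
    rw [integral_const_mul, integral_rescale_mul _ _ (hc j), ← integral_const_mul]
    refine integral_congr_ae (Filter.Eventually.of_forall fun u => ?_)
    simp only [mul_smul]; ring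
  · intro j _
    refine Integrable.const_mul ?_ _
    refine Continuous.integrable_of_hasCompactSupport (by fun_prop) ?_
    refine HasCompactSupport.intro (isCompact_closedBall x₀ (2 * (((j : ℝ) + 1) * h)))
      fun x hx => ?_
    rw [mollifier_eq_zero]
    · simp
    · rw [Metric.mem_closedBall, not_le, dist_eq_norm] at hx
      rw [norm_smul, Real.norm_eq_abs, abs_of_pos (inv_pos.2 (hc j)), inv_mul_eq_div,
        le_div_iff₀ (hc j)]
      exact hx.le

lemma integral_higherOrderKernel (l : ℕ) : ∫ x, higherOrderKernel p l x = 1 := by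
  have h := integral_higherOrderKernel_mul (p := p) l (f := fun _ => 1) continuous_const one_pos 0
  simp only [one_pow, inv_one, one_mul, one_smul, sub_zero, mul_one] at h
  rw [h, sum_extrapolationWeight]
  simp [integral_mollifier]

/-- The bias of the kernel estimator for Hölder functions. -/
lemma exists_bias_le (p : ℕ) {s : ℝ} (hs : 0 < s) : ∃ C, 0 < C ∧ ∀ (L : ℝ) (f : E p → ℝ),
    0 < L → IsHolder s L f → ∀ (h : ℝ) (x₀ : E p), 0 < h →
    |(∫ x, (h ^ p)⁻¹ * higherOrderKernel p (holderOrder s) (h⁻¹ • (x - x₀)) * f x) - f x₀|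
      ≤ C * (L * h ^ s) := by
  set l := holderOrder s
  set W := ∑ j ∈ Finset.range (l + 1), |extrapolationWeight l j| * ((j : ℝ) + 1) ^ s
  have hW : 0 ≤ W := by positivity
  -- `W` is the extrapolation constant, `p^l` comes from restriction to lines, `2^s` from the
  -- support radius of the mollifier; `+ 1` only ensures positivity.
  refine ⟨W * ((p : ℝ) ^ l * 2 ^ s) + 1, by positivity, fun L f hL hf h x₀ hh => ?_⟩
  have hfc : Continuous f := hf.1.continuous
  rw [integral_higherOrderKernel_mul l hfc hh]
  have h1 : f x₀ = ∫ u, mollifier p u * f x₀ := by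
    rw [integral_mul_const, integral_mollifier, one_mul]
  conv_lhs => rw [h1]
  rw [← integral_sub (integrable_mollifier_mul (by fun_prop)) (integrable_mollifier.mul_const _)]
  set C := W * ((p : ℝ) ^ l * 2 ^ s)
  have h2 : ∀ u, ‖mollifier p u * (∑ j ∈ Finset.range (l + 1),
      extrapolationWeight l j * f (x₀ + ((j : ℝ) + 1) • (h • u))) - mollifier p u * f x₀‖
      ≤ mollifier p u * (C * (L * h ^ s)) := by
    intro u
    rcases le_total 2 ‖u‖ with hu | hu
    · simp [mollifier_eq_zero hu]
    rw [← mul_sub, norm_mul, Real.norm_eq_abs, abs_of_nonneg (mollifier_nonneg u)]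
    refine mul_le_mul_of_nonneg_left ?_ (mollifier_nonneg u)
    have h3 := abs_sum_extrapolationWeight_sub_le hs (M := (p : ℝ) ^ l * L * ‖h • u‖ ^ s)
      (by positivity) (F := fun t : ℝ => f (x₀ + t • (h • u)))
      (hf.1.comp (by fun_prop)) (fun t ht => hf.line hs x₀ (h • u) ht)
    rw [zero_smul, add_zero] at h3
    refine h3.trans ?_
    have h4 : ‖h • u‖ ^ s ≤ 2 ^ s * h ^ s := by
      rw [norm_smul, Real.norm_eq_abs, abs_of_pos hh, mul_comm, Real.mul_rpow (by positivity) hh.le]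
      gcongr
    calc W * ((p : ℝ) ^ l * L * ‖h • u‖ ^ s) ≤ W * ((p : ℝ) ^ l * L * (2 ^ s * h ^ s)) := by gcongr
      _ = _ := by ring
  refine (norm_integral_le_of_norm_le (integrable_mollifier.mul_const _)
    (Filter.Eventually.of_forall h2)).trans ?_
  rw [integral_mul_const, integral_mollifier, one_mul]
  have : 0 < L * h ^ s := by positivity
  nlinarith

/-- Hölder densities are uniformly bounded. -/
lemma exists_density_le (p : ℕ) {s L : ℝ} (hs : 0 < s) (hL : 0 < L) : ∃ B, 0 < B ∧
    ∀ f : E p → ℝ, IsDensity f → IsHolder s L f → ∀ x, f x ≤ B := by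
  obtain ⟨C, hC, hb⟩ := exists_bias_le p hs
  obtain ⟨B, hB0, hB⟩ := exists_abs_higherOrderKernel_le p (holderOrder s)
  refine ⟨B + C * L, by positivity, fun f hf hh x => ?_⟩
  -- At bandwidth `1` the smoothed value is at most `B`, because `f` has integral `1`, and it is
  -- within `C * L` of `f x`.
  have h1 := hb L f hL hh 1 x one_pos
  simp only [one_pow, inv_one, one_mul, one_smul, Real.one_rpow, mul_one] at h1
  have h2 : |∫ y, higherOrderKernel p (holderOrder s) (y - x) * f y| ≤ B := by
    rw [← Real.norm_eq_abs]
    refine (norm_integral_le_of_norm_le (hf.2.1.const_mul B)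
      (Filter.Eventually.of_forall fun y => ?_)).trans ?_
    · rw [norm_mul, Real.norm_eq_abs, Real.norm_eq_abs, abs_of_nonneg (hf.1 y)]
      exact mul_le_mul_of_nonneg_right (hB _) (hf.1 y)
    · rw [integral_const_mul, hf.2.2, mul_one]
  have h3 := abs_le.1 h1
  have h4 := abs_le.1 h2
  linarith

end Kernel

end WassersteinDensity

namespace WassersteinDensity

variable {p : ℕ}

/-! ### Comparison of the `ℓ_q` and Euclidean norms -/

section Norms

lemma ellNorm_eq {q : ℝ≥0∞} [Fact (1 ≤ q)] (x : E p) :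
    ellNorm q x = ‖((PiLp.continuousLinearEquiv 2 ℝ (fun _ : Fin p => ℝ)).trans
      (PiLp.continuousLinearEquiv q ℝ (fun _ : Fin p => ℝ)).symm) x‖ := rfl

lemma continuous_ellNorm {q : ℝ≥0∞} (hq : 1 ≤ q) : Continuous (ellNorm q : E p → ℝ) := by
  have : Fact (1 ≤ q) := ⟨hq⟩
  simp_rw [funext (ellNorm_eq (p := p) (q := q))]
  fun_prop

lemma ellNorm_nonneg {q : ℝ≥0∞} (hq : 1 ≤ q) (x : E p) : 0 ≤ ellNorm q x := by
  have : Fact (1 ≤ q) := ⟨hq⟩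
  exact norm_nonneg _

lemma exists_ellNorm_le (p : ℕ) {q : ℝ≥0∞} (hq : 1 ≤ q) :
    ∃ C, 0 < C ∧ ∀ x : E p, ellNorm q x ≤ C * ‖x‖ := by
  have : Fact (1 ≤ q) := ⟨hq⟩
  set A := (PiLp.continuousLinearEquiv 2 ℝ (fun _ : Fin p => ℝ)).trans
      (PiLp.continuousLinearEquiv q ℝ (fun _ : Fin p => ℝ)).symm
  refine ⟨‖(A : E p →L[ℝ] PiLp q fun _ : Fin p => ℝ)‖ + 1, by positivity, fun x => ?_⟩
  rw [ellNorm_eq]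
  have := (A : E p →L[ℝ] PiLp q fun _ : Fin p => ℝ).le_opNorm x
  refine this.trans ?_
  gcongr
  linarith

lemma exists_le_ellNorm (p : ℕ) {q : ℝ≥0∞} (hq : 1 ≤ q) :
    ∃ C, 0 < C ∧ ∀ x : E p, ‖x‖ ≤ C * ellNorm q x := by
  have : Fact (1 ≤ q) := ⟨hq⟩
  set A := (PiLp.continuousLinearEquiv 2 ℝ (fun _ : Fin p => ℝ)).trans
      (PiLp.continuousLinearEquiv q ℝ (fun _ : Fin p => ℝ)).symm
  refine ⟨‖(A.symm : (PiLp q fun _ : Fin p => ℝ) →L[ℝ] E p)‖ + 1, by positivity, fun x => ?_⟩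
  rw [ellNorm_eq]
  have := (A.symm : (PiLp q fun _ : Fin p => ℝ) →L[ℝ] E p).le_opNorm (A x)
  simp only [ContinuousLinearEquiv.coe_coe, ContinuousLinearEquiv.symm_apply_apply] at this
  refine this.trans ?_
  gcongr
  linarith

end Norms

/-! ### Laws with a density -/

section Law

lemma IsDensity.isProbabilityMeasure {f : E p → ℝ} (hf : IsDensity f) :
    IsProbabilityMeasure (law f) := by
  refine ⟨?_⟩
  rw [law, withDensity_apply _ MeasurableSet.univ, Measure.restrict_univ,
    ← ofReal_integral_eq_lintegral_ofReal hf.2.1 (Filter.Eventually.of_forall hf.1), hf.2.2,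
    ENNReal.ofReal_one]

lemma integral_law {f : E p → ℝ} (hf : Continuous f) (h0 : ∀ x, 0 ≤ f x) (k : E p → ℝ) :
    ∫ x, k x ∂(law f) = ∫ x, k x * f x := by
  rw [law, integral_withDensity_eq_integral_toReal_smul (by fun_prop)
    (Filter.Eventually.of_forall fun _ => ENNReal.ofReal_lt_top)]
  refine integral_congr_ae (Filter.Eventually.of_forall fun x => ?_)
  simp [ENNReal.toReal_ofReal (h0 x), mul_comm]

lemma law_closedBall_le {f : E p → ℝ} {B : ℝ} (hB : 0 ≤ B) (hf : ∀ x, f x ≤ B) (x₀ : E p) {ρ : ℝ}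
    (hρ : 0 ≤ ρ) :
    law f (Metric.closedBall x₀ ρ)
      ≤ ENNReal.ofReal (B * (volume (Metric.ball (0 : E p) 1)).toReal * ρ ^ p) := by
  rw [law, withDensity_apply _ measurableSet_closedBall]
  calc _ ≤ ∫⁻ _ in Metric.closedBall x₀ ρ, ENNReal.ofReal B :=
        lintegral_mono fun x => ENNReal.ofReal_le_ofReal (hf x)
    _ = _ := by
        rw [setLIntegral_const, Measure.addHaar_closedBall _ _ hρ,
          ENNReal.ofReal_mul (by positivity), ENNReal.ofReal_mul hB,
          ENNReal.ofReal_toReal measure_ball_lt_top.ne, finrank_euclideanSpace, Fintype.card_fin]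
        ring

end Law

/-! ### Effect of contamination on integrals -/

section Coupling

/-- Almost optimal couplings. -/
lemma exists_isCoupling_lintegral_le {q : ℝ≥0∞} {r ε : ℝ} (hr : 1 ≤ r) (hε : 0 < ε)
    {μ ν : Measure (E p)} (h : wasserstein q r μ ν ≤ ENNReal.ofReal ε) :
    ∃ π, IsCoupling π μ ν ∧
      ∫⁻ z, ENNReal.ofReal (ellNorm q (z.1 - z.2) ^ r) ∂π ≤ ENNReal.ofReal (2 * ε) ^ r := by
  have hr0 : 0 < r := one_pos.trans_le hr
  -- Doubling `ε` makes the inequality strict, so no optimal coupling has to exist.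
  have h1 : wasserstein q r μ ν < ENNReal.ofReal (2 * ε) :=
    h.trans_lt ((ENNReal.ofReal_lt_ofReal_iff (by positivity)).2 (by linarith))
  rw [wasserstein, one_div, ENNReal.rpow_inv_lt_iff hr0] at h1
  obtain ⟨π, h2⟩ := iInf_lt_iff.1 h1
  obtain ⟨h3, h4⟩ := iInf_lt_iff.1 h2
  exact ⟨π, h3, h4.le⟩

/-- Integrals of Lipschitz functions with small support against Wasserstein-close measures. -/
lemma abs_integral_sub_integral_le {q : ℝ≥0∞} (hq : 1 ≤ q) {r ε : ℝ} (hr : 1 ≤ r) (hε : 0 < ε)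
    {μ ν : Measure (E p)} [IsProbabilityMeasure μ] [IsProbabilityMeasure ν]
    (h : wasserstein q r μ ν ≤ ENNReal.ofReal ε) {k : E p → ℝ} {Λ Cq m B : ℝ} (hΛ : 0 ≤ Λ)
    (hCq : ∀ x : E p, ‖x‖ ≤ Cq * ellNorm q x) (hCq0 : 0 < Cq)
    (hk : ∀ x y, |k x - k y| ≤ Λ * ‖x - y‖) (hkB : ∀ x, |k x| ≤ B) {S : Set (E p)}
    (hS : MeasurableSet S) (hkS : ∀ x, x ∉ S → k x = 0) (hm : 0 ≤ m)
    (hμ : μ S ≤ ENNReal.ofReal m) (hν : ν S ≤ ENNReal.ofReal m) :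
    |∫ x, k x ∂μ - ∫ x, k x ∂ν| ≤ Λ * Cq * (2 * ε) * (2 * m) ^ (1 - 1 / r) := by
  have hr0 : 0 < r := one_pos.trans_le hr
  obtain ⟨π, ⟨hπ1, hπ2⟩, hπ⟩ := exists_isCoupling_lintegral_le hr hε h
  have hkc : Continuous k :=
    (LipschitzWith.of_dist_le_mul (K := ⟨Λ, hΛ⟩) fun x y => by
      rw [Real.dist_eq, dist_eq_norm]; exact hk x y).continuous
  have : IsProbabilityMeasure π := ⟨by
    have : μ Set.univ = π Set.univ := by rw [← hπ1, Measure.map_apply measurable_fst .univ]; rfl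
    rw [← this, measure_univ]⟩
  have hi1 : Integrable (fun z : E p × E p => k z.1) π :=
    Integrable.of_bound (by fun_prop) B (Filter.Eventually.of_forall fun z => hkB z.1)
  have hi2 : Integrable (fun z : E p × E p => k z.2) π :=
    Integrable.of_bound (by fun_prop) B (Filter.Eventually.of_forall fun z => hkB z.2)
  have e1 : ∫ x, k x ∂μ = ∫ z, k z.1 ∂π := by
    rw [← hπ1, integral_map measurable_fst.aemeasurable hkc.aestronglyMeasurable]
  have e2 : ∫ x, k x ∂ν = ∫ z, k z.2 ∂π := by
    rw [← hπ2, integral_map measurable_snd.aemeasurable hkc.aestronglyMeasurable]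
  rw [e1, e2, ← integral_sub hi1 hi2]
  -- Off `A` both values of `k` vanish. Localising to `A`, of mass at most `2 * m`, is what gains
  -- the factor `(2 * m)^(1 - 1/r)`.
  set A : Set (E p × E p) := Prod.fst ⁻¹' S ∪ Prod.snd ⁻¹' S
  have hA : MeasurableSet A := (measurable_fst hS).union (measurable_snd hS)
  have hπA : π A ≤ ENNReal.ofReal (2 * m) := by
    refine (measure_union_le _ _).trans ?_
    rw [← Measure.map_apply measurable_fst hS, ← Measure.map_apply measurable_snd hS, hπ1, hπ2,
      two_mul, ENNReal.ofReal_add hm hm]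
    exact add_le_add hμ hν
  set N : E p × E p → ℝ := fun z => ellNorm q (z.1 - z.2)
  have hN : Continuous N := (continuous_ellNorm hq).comp (continuous_fst.sub continuous_snd)
  have hN0 : ∀ z, 0 ≤ N z := fun z => ellNorm_nonneg hq _
  have hLr : eLpNorm N (ENNReal.ofReal r) (π.restrict A) ≤ ENNReal.ofReal (2 * ε) := by
    rw [eLpNorm_eq_lintegral_rpow_enorm_toReal (by simpa using hr0) ENNReal.ofReal_ne_top,
      ENNReal.toReal_ofReal hr0.le, one_div, ENNReal.rpow_inv_le_iff hr0]
    refine le_trans ?_ hπ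
    refine (lintegral_mono' Measure.restrict_le_self fun z => ?_)
    rw [Real.enorm_eq_ofReal (hN0 z), ENNReal.ofReal_rpow_of_nonneg (hN0 z) hr0.le]
  -- Hölder's inequality on the finite measure `π.restrict A`, from `L^r` to `L^1`.
  have hL1 := eLpNorm_le_eLpNorm_mul_rpow_measure_univ (μ := π.restrict A)
    (p := 1) (q := ENNReal.ofReal r) (by simpa using hr) hN.aestronglyMeasurable
  rw [ENNReal.toReal_ofReal hr0.le, ENNReal.toReal_one, div_one, Measure.restrict_apply_univ,
    eLpNorm_one_eq_lintegral_enorm] at hL1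
  have hexp : 0 ≤ 1 - 1 / r := by
    rw [sub_nonneg, div_le_one hr0]; exact hr
  have hmain : ∫⁻ z, ‖k z.1 - k z.2‖ₑ ∂π
      ≤ ENNReal.ofReal (Λ * Cq) * (ENNReal.ofReal (2 * ε) * ENNReal.ofReal (2 * m) ^ (1 - 1 / r)) :=
    calc ∫⁻ z, ‖k z.1 - k z.2‖ₑ ∂π
        = ∫⁻ z in A, ‖k z.1 - k z.2‖ₑ ∂π := by
          rw [setLIntegral_eq_of_support_subset]
          intro z hz
          by_contra hzA
          have : z.1 ∉ S ∧ z.2 ∉ S := by simpa [A] using hzA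
          exact hz (by simp [hkS _ this.1, hkS _ this.2])
      _ ≤ ∫⁻ z in A, ENNReal.ofReal (Λ * Cq) * ‖N z‖ₑ ∂π := by
          refine lintegral_mono fun z => ?_
          rw [Real.enorm_eq_ofReal_abs, Real.enorm_eq_ofReal (hN0 z),
            ← ENNReal.ofReal_mul (by positivity)]
          refine ENNReal.ofReal_le_ofReal ((hk _ _).trans ?_)
          rw [mul_assoc]
          exact mul_le_mul_of_nonneg_left (hCq _) hΛ
      _ = ENNReal.ofReal (Λ * Cq) * ∫⁻ z in A, ‖N z‖ₑ ∂π :=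
          lintegral_const_mul _ hN.measurable.enorm
      _ ≤ _ := by
          gcongr
          refine hL1.trans ?_
          gcongr
  rw [← Real.norm_eq_abs]
  have h5 := (enorm_integral_le_lintegral_enorm (fun z : E p × E p => k z.1 - k z.2)).trans hmain
  rw [ENNReal.ofReal_rpow_of_nonneg (by positivity) hexp, ← ENNReal.ofReal_mul (by positivity),
    ← ENNReal.ofReal_mul (by positivity), ← ofReal_norm,
    ENNReal.ofReal_le_ofReal_iff (by positivity)] at h5
  refine h5.trans (le_of_eq ?_)
  ring

end Coupling

/-! ### Bias and variance of a sample mean -/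

section Risk

/-- The bias-variance bound for linear statistics. -/
lemma lintegral_linear_statistic_le {n : ℕ} {P : Measure (E p)} [IsProbabilityMeasure P]
    {k : E p → ℝ} (hk : Measurable k) {B : ℝ} (hB : ∀ x, |k x| ≤ B) (c θ : ℝ) :
    ∫⁻ X : Fin n → E p, ENNReal.ofReal ((c * ∑ i, k (X i) - θ) ^ 2) ∂(Measure.pi fun _ => P)
      ≤ ENNReal.ofReal (n * c ^ 2 * ∫ x, k x ^ 2 ∂P + (n * c * ∫ x, k x ∂P - θ) ^ 2) := by
  have hkL : MemLp k 2 P :=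
    MemLp.of_bound hk.aestronglyMeasurable B (Filter.Eventually.of_forall hB)
  set Q := Measure.pi fun _ : Fin n => P
  have hkm : ∀ i, MemLp (fun X : Fin n → E p => k (X i)) 2 Q := fun i =>
    hkL.comp_measurePreserving (measurePreserving_eval _ i)
  have hSm : MemLp (fun X : Fin n → E p => ∑ i, k (X i)) 2 Q := memLp_finsetSum _ fun i _ => hkm i
  have hT : MemLp (fun X : Fin n → E p => c * ∑ i, k (X i) - θ) 2 Q :=
    (hSm.const_mul c).sub (memLp_const θ)
  rw [← ofReal_integral_eq_lintegral_ofReal hT.integrable_sq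
    (Filter.Eventually.of_forall fun _ => sq_nonneg _)]
  refine ENNReal.ofReal_le_ofReal ?_
  have h1 := ProbabilityTheory.variance_eq_sub hT
  have h2 : ∫ X : Fin n → E p, (c * ∑ i, k (X i) - θ) ∂Q = n * c * ∫ x, k x ∂P - θ := by
    rw [integral_sub ((hSm.const_mul c).integrable one_le_two) (integrable_const _),
      integral_const_mul, integral_finsetSum _ fun i _ => (hkm i).integrable one_le_two]
    have : ∀ i, ∫ X : Fin n → E p, k (X i) ∂Q = ∫ x, k x ∂P := fun i =>
      integral_comp_eval (μ := fun _ : Fin n => P) hk.aestronglyMeasurable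
    simp [this]; ring
  have h3 : ProbabilityTheory.variance (fun X : Fin n → E p => c * ∑ i, k (X i) - θ) Q
      ≤ n * c ^ 2 * ∫ x, k x ^ 2 ∂P := by
    rw [ProbabilityTheory.variance_sub_const (hSm.const_mul c).aestronglyMeasurable,
      ProbabilityTheory.variance_const_mul]
    have h4 := ProbabilityTheory.variance_sum_pi (μ := fun _ : Fin n => P) (X := fun _ => k)
      fun _ => hkL
    have h5 : (∑ i : Fin n, fun X : Fin n → E p => k (X i)) = fun X => ∑ i, k (X i) := by
      ext X; simp
    rw [h5] at h4
    rw [h4, Finset.sum_const, Finset.card_univ, Fintype.card_fin, nsmul_eq_mul]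
    have h6 := ProbabilityTheory.variance_le_expectation_sq hk.aestronglyMeasurable (μ := P)
    simp only [Pi.pow_apply] at h6
    calc _ ≤ c ^ 2 * (n * ∫ x, k x ^ 2 ∂P) := by gcongr
      _ = _ := by ring
  simp only [Pi.pow_apply] at h1
  rw [h2] at h1
  linarith

end Risk

end WassersteinDensity

namespace WassersteinDensity

variable {p : ℕ}

/-! ### Arithmetic of the rate and the bandwidth -/

section Rate

lemma bandwidth_pos {n : ℕ} (hn : 1 ≤ n) (s r ε : ℝ) : 0 < bandwidth p n s r ε :=
  lt_max_of_lt_left (Real.rpow_pos_of_pos (by exact_mod_cast hn) _)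

lemma bandwidth_rpow {n : ℕ} {s r ε : ℝ} (hs : 0 < s) (hε : 0 < ε) :
    bandwidth p n s r ε ^ (2 * s) = rate p n s r ε := by
  have hn : (0 : ℝ) ≤ n := n.cast_nonneg
  rw [bandwidth, rate, (Real.monotoneOn_rpow_Ici_of_exponent_nonneg (by positivity)).map_max
    (Set.mem_Ici.2 (by positivity)) (Set.mem_Ici.2 (by positivity)), ← Real.rpow_mul hn,
    ← Real.rpow_mul hε.le]
  congr 2 <;> ring

lemma inv_le_bandwidth_rpow {n : ℕ} (hn : 1 ≤ n) {s : ℝ} (hs : 0 < s) (r ε : ℝ) :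
    (n : ℝ)⁻¹ ≤ bandwidth p n s r ε ^ (2 * s + p) := by
  have hn' : (0 : ℝ) < n := by exact_mod_cast hn
  have he : 0 < 2 * s + p := by positivity
  calc (n : ℝ)⁻¹ = ((n : ℝ) ^ (-1 / (2 * s + (p : ℝ)))) ^ (2 * s + p) := by
        rw [← Real.rpow_mul hn'.le, div_mul_cancel₀ _ he.ne', Real.rpow_neg_one]
    _ ≤ _ := by
        gcongr
        exact le_max_left _ _

lemma le_bandwidth_rpow (n : ℕ) {s r ε : ℝ} (hs : 0 < s) (hr : 1 ≤ r) (hε : 0 < ε) :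
    ε ≤ bandwidth p n s r ε ^ (s + 1 + p / r) := by
  have he : 0 < s + 1 + p / r := by positivity
  calc ε = (ε ^ (1 / (s + 1 + (p : ℝ) / r))) ^ (s + 1 + p / r) := by
        rw [← Real.rpow_mul hε.le, div_mul_cancel₀ _ he.ne', Real.rpow_one]
    _ ≤ _ := by
        gcongr
        exact le_max_right _ _

end Rate

/-! ### The upper bound -/

section UpperBound

lemma exists_higherOrderKernel_lipschitz (p l : ℕ) : ∃ Λ : ℝ, 0 ≤ Λ ∧
    ∀ x y : E p, |higherOrderKernel p l x - higherOrderKernel p l y| ≤ Λ * ‖x - y‖ := by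
  obtain ⟨A, hA⟩ := (contDiff_higherOrderKernel (p := p) l).lipschitzWith_of_hasCompactSupport
    (hasCompactSupport_higherOrderKernel l) (by simp)
  exact ⟨A, A.2, fun x y => by simpa using hA.norm_sub_le x y⟩

/-- The risk of the kernel estimator in terms of its bandwidth. -/
lemma exists_kde_risk_le (p : ℕ) {s L s' L' : ℝ} (hs : 0 < s) (hL : 0 < L) (hs' : 0 < s')
    (hL' : 0 < L') {q : ℝ≥0∞} (hq : 1 ≤ q) {r : ℝ} (hr : 1 ≤ r) :
    ∃ C₁ C₂ C₃ : ℝ, 0 < C₁ ∧ 0 < C₂ ∧ 0 < C₃ ∧ ∀ (x₀ : E p) (n : ℕ), 1 ≤ n → ∀ ε : ℝ, 0 < ε →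
      ∀ h : ℝ, 0 < h → ∀ f g : E p → ℝ, Admissible s L s' L' q r ε f g →
      risk x₀ (kde (n := n) (higherOrderKernel p (holderOrder s)) h x₀) f g
        ≤ ENNReal.ofReal (C₁ * ((n : ℝ)⁻¹ * h ^ (-(p : ℝ)))
          + (C₂ * (ε * h ^ (-(1 + p / r))) + C₃ * h ^ s) ^ 2) := by
  have hr0 : 0 < r := one_pos.trans_le hr
  set l := holderOrder s
  obtain ⟨B, hB0, hB⟩ := exists_abs_higherOrderKernel_le p l
  obtain ⟨Λ, hΛ0, hΛ⟩ := exists_higherOrderKernel_lipschitz p l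
  obtain ⟨Cb, hCb0, hCb⟩ := exists_bias_le p hs
  obtain ⟨Bf, hBf0, hBf⟩ := exists_density_le p hs hL
  obtain ⟨Bg, hBg0, hBg⟩ := exists_density_le p hs' hL'
  obtain ⟨Cq, hCq0, hCq⟩ := exists_le_ellNorm p hq
  set V := (volume (Metric.ball (0 : E p) 1)).toReal
  -- `D * h^p` bounds the mass that either law gives to the ball supporting the rescaled kernel;
  -- using `Bf + Bg` gives one constant for both.
  set D := (Bf + Bg) * V * (2 * ((l : ℝ) + 1)) ^ p
  have hD : 0 ≤ D := by positivity
  refine ⟨B ^ 2 * D + 1, Λ * Cq * 2 * (2 * D) ^ (1 - 1 / r) + 1, Cb * L, by positivity,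
    by positivity, by positivity, fun x₀ n hn ε hε h hh f g ⟨hfd, hfh, hgd, hgh, hW⟩ => ?_⟩
  have hn0 : (0 : ℝ) < n := by exact_mod_cast hn
  have := hfd.isProbabilityMeasure
  have := hgd.isProbabilityMeasure
  set k : E p → ℝ := fun x => higherOrderKernel p l (h⁻¹ • (x - x₀))
  have hkc : Continuous k := by
    have := (contDiff_higherOrderKernel (p := p) l).continuous
    fun_prop
  have hkB : ∀ x, |k x| ≤ B := fun x => hB _
  set S := Metric.closedBall x₀ (2 * ((l : ℝ) + 1) * h)
  have hkS : ∀ x, x ∉ S → k x = 0 := by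
    intro x hx
    refine higherOrderKernel_eq_zero l ?_
    rw [Metric.mem_closedBall, not_le, dist_eq_norm] at hx
    rw [norm_smul, Real.norm_eq_abs, abs_of_pos (inv_pos.2 hh), inv_mul_eq_div, le_div_iff₀ hh]
    exact hx.le
  have hkL : ∀ x y, |k x - k y| ≤ Λ * h⁻¹ * ‖x - y‖ := by
    intro x y
    refine (hΛ _ _).trans (le_of_eq ?_)
    rw [← smul_sub, sub_sub_sub_cancel_right, norm_smul, Real.norm_eq_abs,
      abs_of_pos (inv_pos.2 hh)]
    ring
  have hmass : ∀ (u : E p → ℝ) (M : ℝ), 0 ≤ M → M ≤ Bf + Bg → (∀ x, u x ≤ M) →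
      law u S ≤ ENNReal.ofReal (D * h ^ p) := by
    intro u M hM0 hM hu
    refine (law_closedBall_le hM0 hu x₀ (by positivity)).trans (ENNReal.ofReal_le_ofReal ?_)
    rw [mul_pow]
    calc M * V * ((2 * ((l : ℝ) + 1)) ^ p * h ^ p)
        ≤ (Bf + Bg) * V * ((2 * ((l : ℝ) + 1)) ^ p * h ^ p) := by gcongr
      _ = _ := by ring
  have hmf := hmass f Bf hBf0.le (by linarith) (hBf f hfd hfh)
  have hmg := hmass g Bg hBg0.le (by linarith) (hBg g hgd hgh)
  have hbias := hCb L f hL hfh h x₀ hh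
  have htrans := abs_integral_sub_integral_le hq hr hε hW (by positivity) hCq hCq0 hkL hkB
    measurableSet_closedBall hkS (by positivity) hmg hmf
  have hkde : kde (n := n) (higherOrderKernel p l) h x₀
      = fun X => (1 / ((n : ℝ) * h ^ p)) * ∑ i, k (X i) := by
    ext X; simp [kde, k]
  rw [risk, hkde]
  refine (lintegral_linear_statistic_le hkc.measurable hkB _ (f x₀)).trans
    (ENNReal.ofReal_le_ofReal (add_le_add ?_ ?_))
  · have h1 : ∫ x, k x ^ 2 ∂(law g) ≤ B ^ 2 * (D * h ^ p) :=
      calc ∫ x, k x ^ 2 ∂(law g) ≤ ∫ x, S.indicator (fun _ => B ^ 2) x ∂(law g) := by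
            refine integral_mono_of_nonneg (Filter.Eventually.of_forall fun _ => sq_nonneg _)
              ((integrable_const _).indicator measurableSet_closedBall)
              (Filter.Eventually.of_forall fun x => ?_)
            by_cases hx : x ∈ S
            · simp only [Set.indicator_of_mem hx]
              exact sq_le_sq.2 ((hkB x).trans (le_abs_self _))
            · simp [hkS x hx, hx]
        _ = B ^ 2 * (law g).real S := by
            rw [integral_indicator_const _ measurableSet_closedBall, smul_eq_mul, mul_comm]
        _ ≤ _ := by
            gcongr
            exact ENNReal.toReal_le_of_le_ofReal (by positivity) hmg
    have h2 : (h ^ (-(p : ℝ)) : ℝ) = (h ^ p)⁻¹ := by rw [Real.rpow_neg hh.le, Real.rpow_natCast]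
    rw [h2]
    calc _ ≤ n * (1 / ((n : ℝ) * h ^ p)) ^ 2 * (B ^ 2 * (D * h ^ p)) := by gcongr
      _ = (B ^ 2 * D) * ((n : ℝ)⁻¹ * (h ^ p)⁻¹) := by field_simp
      _ ≤ _ := by gcongr; linarith
  · have h0 : (n : ℝ) * (1 / ((n : ℝ) * h ^ p)) = (h ^ p)⁻¹ := by field_simp
    rw [h0]
    have h1 : ∫ x, (h ^ p)⁻¹ * k x * f x = (h ^ p)⁻¹ * ∫ x, k x ∂(law f) := by
      rw [integral_law hfh.1.continuous hfd.1, ← integral_const_mul]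
      simp only [mul_assoc]
    rw [h1] at hbias
    refine sq_le_sq.2 (le_trans ?_ (le_abs_self _))
    -- Contamination error plus smoothing bias.
    have h2 : (h ^ p)⁻¹ * ∫ x, k x ∂(law g) - f x₀
        = (h ^ p)⁻¹ * (∫ x, k x ∂(law g) - ∫ x, k x ∂(law f))
          + ((h ^ p)⁻¹ * ∫ x, k x ∂(law f) - f x₀) := by ring
    rw [h2]
    refine (abs_add_le _ _).trans (add_le_add ?_ (hbias.trans (by rw [mul_assoc])))
    rw [abs_mul, abs_of_pos (inv_pos.2 (pow_pos hh p))]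
    have h3 : (h ^ p)⁻¹ * (h⁻¹ * (h ^ p) ^ (1 - 1 / r)) = h ^ (-(1 + p / r)) := by
      rw [← Real.rpow_natCast, ← Real.rpow_mul hh.le, ← Real.rpow_neg hh.le, ← Real.rpow_neg_one h,
        ← Real.rpow_add hh, ← Real.rpow_add hh]
      congr 1
      field_simp
      ring
    have hexp : 0 ≤ 1 - 1 / r := by rw [sub_nonneg, div_le_one hr0]; exact hr
    calc _ ≤ (h ^ p)⁻¹ * (Λ * h⁻¹ * Cq * (2 * ε) * (2 * (D * h ^ p)) ^ (1 - 1 / r)) := by gcongr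
      _ = Λ * Cq * 2 * (2 * D) ^ (1 - 1 / r)
          * (ε * ((h ^ p)⁻¹ * (h⁻¹ * (h ^ p) ^ (1 - 1 / r)))) := by
          rw [← mul_assoc 2 D, Real.mul_rpow (by positivity) (by positivity)]; ring
      _ = Λ * Cq * 2 * (2 * D) ^ (1 - 1 / r) * (ε * h ^ (-(1 + p / r))) := by rw [h3]
      _ ≤ _ := by gcongr; linarith

/-- Kernel estimators with bandwidth of the right order attain the rate. -/
lemma exists_kde_worstRisk_le (p : ℕ) {s L s' L' : ℝ} (hs : 0 < s) (hL : 0 < L) (hs' : 0 < s')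
    (hL' : 0 < L') {q : ℝ≥0∞} (hq : 1 ≤ q) {r : ℝ} (hr : 1 ≤ r) {a b : ℝ} (ha : 0 < a)
    (hab : a ≤ b) :
    ∃ C : ℝ, 0 < C ∧ ∀ (x₀ : E p) (n : ℕ), 1 ≤ n → ∀ ε : ℝ, 0 < ε →
      ∀ h : ℝ, a * bandwidth p n s r ε ≤ h → h ≤ b * bandwidth p n s r ε →
      worstRisk s L s' L' q r ε x₀ (kde (n := n) (higherOrderKernel p (holderOrder s)) h x₀)
        ≤ ENNReal.ofReal (C * rate p n s r ε) := by
  have hr0 : 0 < r := one_pos.trans_le hr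
  have hb : 0 < b := ha.trans_le hab
  obtain ⟨C₁, C₂, C₃, h1, h2, h3, hmain⟩ := exists_kde_risk_le p hs hL hs' hL' hq hr
  refine ⟨C₁ * a ^ (-(p : ℝ)) + (C₂ * a ^ (-(1 + p / r)) + C₃ * b ^ s) ^ 2, by positivity,
    fun x₀ n hn ε hε h hah hhb => ?_⟩
  set H := bandwidth p n s r ε
  have hH : 0 < H := bandwidth_pos hn s r ε
  have hh : 0 < h := (mul_pos ha hH).trans_le hah
  refine iSup_le fun f => iSup_le fun g => iSup_le fun hfg => ?_
  refine (hmain x₀ n hn ε hε h hh f g hfg).trans (ENNReal.ofReal_le_ofReal ?_)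
  -- The lower bound on `h` controls the negative powers, in the variance and the contamination
  -- error; the upper bound controls the smoothing bias.
  have hlow : ∀ e : ℝ, 0 ≤ e → h ^ (-e) ≤ a ^ (-e) * H ^ (-e) := fun e he => by
    rw [← Real.mul_rpow ha.le hH.le]
    exact Real.rpow_le_rpow_of_nonpos (by positivity) hah (by linarith)
  have hup : h ^ s ≤ b ^ s * H ^ s := by
    rw [← Real.mul_rpow hb.le hH.le]
    gcongr
  have hvar : (n : ℝ)⁻¹ * h ^ (-(p : ℝ)) ≤ a ^ (-(p : ℝ)) * H ^ (2 * s) :=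
    calc _ ≤ H ^ (2 * s + p) * (a ^ (-(p : ℝ)) * H ^ (-(p : ℝ))) :=
          mul_le_mul (inv_le_bandwidth_rpow hn hs r ε) (hlow p p.cast_nonneg) (by positivity)
            (by positivity)
      _ = a ^ (-(p : ℝ)) * (H ^ (2 * s + p) * H ^ (-(p : ℝ))) := by ring
      _ = _ := by rw [← Real.rpow_add hH]; congr 2; ring
  have hcon : ε * h ^ (-(1 + p / r)) ≤ a ^ (-(1 + p / r)) * H ^ s :=
    calc _ ≤ H ^ (s + 1 + p / r) * (a ^ (-(1 + p / r)) * H ^ (-(1 + p / r))) :=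
          mul_le_mul (le_bandwidth_rpow n hs hr hε) (hlow _ (by positivity)) (by positivity)
            (by positivity)
      _ = a ^ (-(1 + p / r)) * (H ^ (s + 1 + p / r) * H ^ (-(1 + p / r))) := by ring
      _ = _ := by rw [← Real.rpow_add hH]; congr 2; ring
  rw [← bandwidth_rpow hs hε]
  have hsq : H ^ (2 * s) = (H ^ s) ^ 2 := by
    rw [← Real.rpow_natCast (H ^ s), ← Real.rpow_mul hH.le]; congr 1; push_cast; ring
  calc _ ≤ C₁ * (a ^ (-(p : ℝ)) * H ^ (2 * s))
        + (C₂ * (a ^ (-(1 + p / r)) * H ^ s) + C₃ * (b ^ s * H ^ s)) ^ 2 := by gcongr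
    _ = _ := by
        change _ = _ * H ^ (2 * s)
        rw [hsq]; ring

lemma measurable_kde {n : ℕ} {K : E p → ℝ} (hK : Measurable K) (h : ℝ) (x₀ : E p) :
    Measurable (kde (n := n) K h x₀) := by
  unfold kde
  fun_prop

end UpperBound

end WassersteinDensity

namespace WassersteinDensity

/-! ### Le Cam's two-point method -/

section TwoPoints

lemma lintegral_prod_pi {n : ℕ} {Ω : Type*} [MeasurableSpace Ω] (P : Measure Ω)
    [IsProbabilityMeasure P] {z : Fin n → Ω → ℝ≥0∞} (hz : ∀ i, Measurable (z i)) :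
    ∫⁻ X : Fin n → Ω, ∏ i, z i (X i) ∂(Measure.pi fun _ => P) = ∏ i, ∫⁻ x, z i x ∂P := by
  have h1 := ProbabilityTheory.iIndepFun_pi (μ := fun _ : Fin n => P) (X := z)
    fun i => (hz i).aemeasurable
  have h2 := ProbabilityTheory.lintegral_prod_eq_prod_lintegral_of_indepFun Finset.univ
    (fun (i : Fin n) (X : Fin n → Ω) => z i (X i)) h1
    fun i => (hz i).comp (measurable_pi_apply i)
  rw [h2]
  refine Finset.prod_congr rfl fun i _ => ?_
  exact (measurePreserving_eval (fun _ : Fin n => P) i).lintegral_comp (hz i)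

/-- The likelihood ratio of an i.i.d. sample is the product of the individual ratios. It suffices to
check boxes, where the indicator factorises too. -/
lemma pi_withDensity {n : ℕ} {Ω : Type*} [MeasurableSpace Ω] (P : Measure Ω)
    [IsProbabilityMeasure P] {z : Ω → ℝ≥0∞} (hz : Measurable z)
    [IsProbabilityMeasure (P.withDensity z)] :
    (Measure.pi fun _ : Fin n => P.withDensity z)
      = (Measure.pi fun _ : Fin n => P).withDensity fun X => ∏ i, z (X i) := by
  refine Measure.pi_eq fun s hs => ?_
  rw [withDensity_apply _ (MeasurableSet.univ_pi hs),
    ← lintegral_indicator (MeasurableSet.univ_pi hs)]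
  have h1 : ∀ X : Fin n → Ω, (Set.univ.pi s).indicator (fun X => ∏ i, z (X i)) X
      = ∏ i, (s i).indicator z (X i) := by
    intro X
    by_cases hX : X ∈ Set.univ.pi s
    · rw [Set.indicator_of_mem hX]
      exact Finset.prod_congr rfl fun i _ => (Set.indicator_of_mem (hX i (Set.mem_univ i)) _).symm
    · rw [Set.indicator_of_notMem hX]
      simp only [Set.mem_univ_pi, not_forall] at hX
      obtain ⟨i, hi⟩ := hX
      exact (Finset.prod_eq_zero (Finset.mem_univ i) (Set.indicator_of_notMem hi _)).symm
  simp_rw [h1]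
  rw [lintegral_prod_pi P fun i => hz.indicator (hs i)]
  refine Finset.prod_congr rfl fun i _ => ?_
  rw [withDensity_apply _ (hs i), lintegral_indicator (hs i)]

/-- Le Cam's two point bound, with the second moment of the likelihood ratio. -/
lemma two_point_bound {Ω : Type*} [MeasurableSpace Ω] (P : Measure Ω)
    {Z : Ω → ℝ≥0∞} (hZ : Measurable Z) [IsProbabilityMeasure (P.withDensity Z)]
    {T : Ω → ℝ} (hT : Measurable T) {a b A : ℝ} {R : ℝ≥0∞} (hA : 0 ≤ A)
    (hZA : ∫⁻ y, Z y ^ 2 ∂P ≤ ENNReal.ofReal (A ^ 2))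
    (ha : ∫⁻ y, ENNReal.ofReal ((T y - a) ^ 2) ∂P ≤ R)
    (hb : ∫⁻ y, ENNReal.ofReal ((T y - b) ^ 2) ∂(P.withDensity Z) ≤ R) :
    ENNReal.ofReal ((a - b) ^ 2 / (A + 1) ^ 2) ≤ R := by
  set Q := P.withDensity Z
  have hma : Measurable fun y => ‖T y - a‖ₑ := (hT.sub_const a).enorm
  have hmb : Measurable fun y => ‖T y - b‖ₑ := (hT.sub_const b).enorm
  have hsq : ∀ x : ℝ, ‖x‖ₑ ^ (2 : ℝ) = ENNReal.ofReal (x ^ 2) := fun x => by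
    rw [Real.enorm_eq_ofReal_abs, ENNReal.ofReal_rpow_of_nonneg (abs_nonneg _) two_pos.le]
    norm_cast
    rw [sq_abs]
  have hR : ∀ x : ℝ≥0∞, x ≤ R → x ^ (1 / (2 : ℝ)) ≤ R ^ (1 / (2 : ℝ)) := fun x hx => by gcongr
  -- Both errors are measured under `Q`. The first returns to `P` by Cauchy–Schwarz against `Z`, at
  -- the cost of a factor `A`; the second costs a factor `1`. Hence `A + 1`.
  have h1 : ‖a - b‖ₑ ≤ ∫⁻ y, ‖T y - a‖ₑ ∂Q + ∫⁻ y, ‖T y - b‖ₑ ∂Q := by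
    rw [← lintegral_add_left hma]
    calc ‖a - b‖ₑ = ∫⁻ _, ‖a - b‖ₑ ∂Q := by simp
      _ ≤ _ := lintegral_mono fun y => by
        have : a - b = (T y - b) - (T y - a) := by ring
        rw [this, add_comm]
        exact enorm_sub_le
  have h2 : ∫⁻ y, ‖T y - a‖ₑ ∂Q ≤ ENNReal.ofReal A * R ^ (1 / (2 : ℝ)) := by
    rw [lintegral_withDensity_eq_lintegral_mul _ hZ hma]
    refine (ENNReal.lintegral_mul_le_Lp_mul_Lq P Real.HolderConjugate.two_two hZ.aemeasurable
      hma.aemeasurable).trans (mul_le_mul' ?_ (hR _ ?_))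
    · simp only [ENNReal.rpow_two]
      calc _ ≤ ENNReal.ofReal (A ^ 2) ^ (1 / (2 : ℝ)) := by gcongr
        _ = _ := by
          rw [ENNReal.ofReal_rpow_of_nonneg (by positivity) (by positivity), ← Real.sqrt_eq_rpow,
            Real.sqrt_sq hA]
    · simpa only [hsq] using ha
  have h3 : ∫⁻ y, ‖T y - b‖ₑ ∂Q ≤ R ^ (1 / (2 : ℝ)) := by
    have h4 := ENNReal.lintegral_mul_le_Lp_mul_Lq Q Real.HolderConjugate.two_two
      (f := fun _ => 1) aemeasurable_const hmb.aemeasurable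
    simp only [Pi.mul_apply, one_mul, ENNReal.one_rpow, lintegral_one, measure_univ] at h4
    refine h4.trans (hR _ ?_)
    simpa only [hsq] using hb
  have h5 : ‖a - b‖ₑ ≤ ENNReal.ofReal (A + 1) * R ^ (1 / (2 : ℝ)) := by
    rw [ENNReal.ofReal_add hA zero_le_one, add_mul, ENNReal.ofReal_one, one_mul]
    exact h1.trans (add_le_add h2 h3)
  have h6 : ENNReal.ofReal ((a - b) ^ 2) ≤ ENNReal.ofReal ((A + 1) ^ 2) * R := by
    rw [← hsq]
    refine (ENNReal.rpow_le_rpow h5 two_pos.le).trans (le_of_eq ?_)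
    rw [ENNReal.mul_rpow_of_nonneg _ _ two_pos.le, ← ENNReal.rpow_mul,
      ENNReal.ofReal_rpow_of_nonneg (by positivity) two_pos.le]
    norm_num
  rw [ENNReal.ofReal_div_of_pos (by positivity)]
  exact ENNReal.div_le_of_le_mul' h6

end TwoPoints

/-! ### Change of variables under a shear -/

section ChangeOfVariables

variable {p : ℕ}

/-- Change of variables for a shear by a function with small Lipschitz constant. -/
lemma lintegral_shear {w : E p → ℝ} (hw : Differentiable ℝ w)
    (hL : ∀ x y, |w x - w y| ≤ 1 / 2 * ‖x - y‖) {e : E p} (he : ‖e‖ = 1) (g : E p → ℝ≥0∞) :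
    ∫⁻ x, g x = ∫⁻ x, ENNReal.ofReal |1 + fderiv ℝ w x e| * g (x + w x • e) := by
  set S : E p → E p := fun x => x + w x • e
  -- The shear is a `1/2`-Lipschitz perturbation of the identity, hence bijective.
  have hap : ApproximatesLinearOn S
      ((ContinuousLinearEquiv.refl ℝ (E p) : E p ≃L[ℝ] E p) : E p →L[ℝ] E p) Set.univ
      (1 / 2) := by
    intro x _ y _
    have h0 : S x - S y - ((ContinuousLinearEquiv.refl ℝ (E p) : E p ≃L[ℝ] E p) : E p →L[ℝ] E p)
        (x - y) = (w x - w y) • e := by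
      simp only [S, ContinuousLinearEquiv.coe_refl, ContinuousLinearMap.id_apply, sub_smul]
      abel
    rw [h0, norm_smul, he, mul_one, Real.norm_eq_abs]
    simpa using hL x y
  have hc : Subsingleton (E p) ∨ (1 / 2 : NNReal)
      < ‖((ContinuousLinearEquiv.refl ℝ (E p)).symm : E p →L[ℝ] E p)‖₊⁻¹ := by
    rcases subsingleton_or_nontrivial (E p) with h | h
    · exact Or.inl h
    · right
      have : ‖((ContinuousLinearEquiv.refl ℝ (E p)).symm : E p →L[ℝ] E p)‖₊ = 1 := by
        simp
      rw [this, inv_one]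
      exact NNReal.half_lt_self one_ne_zero
  have hinj := hap.injOn hc
  have hsurj := hap.surjective hc
  have hder : ∀ x ∈ Set.univ, HasFDerivWithinAt S
      (ContinuousLinearMap.id ℝ (E p) + (fderiv ℝ w x).smulRight e) Set.univ x := fun x _ =>
    ((hasFDerivAt_id x).add ((hw x).hasFDerivAt.smul_const e)).hasFDerivWithinAt
  have h := lintegral_image_eq_lintegral_abs_det_fderiv_mul volume MeasurableSet.univ hder
    hinj g
  rw [Set.image_univ, hsurj.range_eq, Measure.restrict_univ] at h
  rw [h]
  refine lintegral_congr fun x => ?_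
  -- The derivative is a rank-one perturbation of the identity.
  have hdet : (ContinuousLinearMap.id ℝ (E p) + (fderiv ℝ w x).smulRight e).det
      = 1 + fderiv ℝ w x e :=
    LinearMap.transvection.det (fderiv ℝ w x : E p →ₗ[ℝ] ℝ) e
  rw [hdet]

end ChangeOfVariables

end WassersteinDensity

namespace WassersteinDensity

variable {p : ℕ}

/-! ### The bump that drives the perturbation -/

section Wave

/-- A compactly supported smooth function which agrees with a coordinate near the origin. -/
noncomputable def wave (i : Fin p) (x : E p) : ℝ := x i * bump p x

/-- The derivative of `wave i` in direction `i`. -/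
noncomputable def waveDeriv (i : Fin p) (x : E p) : ℝ :=
  fderiv ℝ (wave i) x (EuclideanSpace.single i 1)

lemma contDiff_wave (i : Fin p) : ContDiff ℝ ∞ (wave i) :=
  (EuclideanSpace.proj (𝕜 := ℝ) i).contDiff.mul (bump p).contDiff

lemma wave_eq_zero (i : Fin p) {x : E p} (hx : 2 ≤ ‖x‖) : wave i x = 0 := by
  rw [wave, (bump p).zero_of_le_dist (by simpa [dist_eq_norm, bump] using hx), mul_zero]

lemma hasCompactSupport_wave (i : Fin p) : HasCompactSupport (wave i) :=
  HasCompactSupport.intro (isCompact_closedBall 0 2) fun x hx =>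
    wave_eq_zero i (by simpa using (not_le.1 fun h => hx (by simpa using h)).le)

lemma contDiff_waveDeriv (i : Fin p) : ContDiff ℝ ∞ (waveDeriv i) :=
  ((contDiff_wave i).fderiv_right (m := ∞) (by simp)).clm_apply contDiff_const

lemma waveDeriv_eq_zero (i : Fin p) {x : E p} (hx : 2 < ‖x‖) : waveDeriv i x = 0 := by
  have h : wave i =ᶠ[nhds x] fun _ => 0 := by
    filter_upwards [continuous_norm.continuousAt.eventually_const_lt hx] with y hy
    exact wave_eq_zero i hy.le
  simp [waveDeriv, h.fderiv_eq]

lemma hasCompactSupport_waveDeriv (i : Fin p) : HasCompactSupport (waveDeriv i) :=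
  HasCompactSupport.intro (isCompact_closedBall 0 2) fun x hx =>
    waveDeriv_eq_zero i (by simpa using (not_le.1 fun h => hx (by simpa using h)))

lemma waveDeriv_zero (i : Fin p) : waveDeriv i 0 = 1 := by
  have h : wave i =ᶠ[nhds 0] EuclideanSpace.proj (𝕜 := ℝ) i := by
    filter_upwards [(bump p).eventuallyEq_one] with y hy
    simp [wave, hy]
  rw [waveDeriv, h.fderiv_eq, ContinuousLinearMap.fderiv]
  simp

lemma exists_wave_bounds (i : Fin p) : ∃ Λ B : ℝ, 0 ≤ Λ ∧ 0 ≤ B ∧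
    (∀ x y, |wave i x - wave i y| ≤ Λ * ‖x - y‖) ∧ (∀ x, |waveDeriv i x| ≤ Λ) ∧
    ∀ x, |wave i x| ≤ B := by
  obtain ⟨A, hA⟩ := (contDiff_wave i).lipschitzWith_of_hasCompactSupport
    (hasCompactSupport_wave i) (by simp)
  obtain ⟨B, hB⟩ := (hasCompactSupport_wave i).exists_bound_of_continuous
    (contDiff_wave i).continuous
  refine ⟨A, B, A.2, (norm_nonneg _).trans (hB 0), fun x y => by simpa using hA.norm_sub_le x y,
    fun x => ?_, hB⟩
  have h1 := (fderiv ℝ (wave i) x).le_opNorm (EuclideanSpace.single i 1)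
  have h2 := norm_fderiv_le_of_lipschitz ℝ hA (x₀ := x)
  simp only [PiLp.norm_single, norm_one, mul_one] at h1
  exact h1.trans h2

end Wave

/-! ### The base density, flat near `x₀` -/

section Base

lemma mollifier_eq_of_norm_le {x : E p} (hx : ‖x‖ ≤ 1) : mollifier p x = mollifier p 0 := by
  rw [mollifier, ContDiffBump.normed_def, ContDiffBump.normed_def,
    (bump p).one_of_mem_closedBall (by simpa [bump] using hx),
    (bump p).one_of_mem_closedBall (by simp [bump])]

lemma mollifier_zero_pos : 0 < mollifier p 0 := by
  rw [mollifier, ContDiffBump.normed_def, (bump p).one_of_mem_closedBall (by simp [bump])]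
  exact one_div_pos.2 (bump p).integral_pos

/-- The mollifier at scale `σ`, centred at `x₀`. -/
noncomputable def baseDensity (σ : ℝ) (x₀ x : E p) : ℝ := (σ ^ p)⁻¹ * mollifier p (σ⁻¹ • (x - x₀))

lemma contDiff_baseDensity (σ : ℝ) (x₀ : E p) : ContDiff ℝ ∞ (baseDensity σ x₀) :=
  contDiff_const.mul (contDiff_mollifier.comp ((contDiff_id.sub contDiff_const).const_smul _))

lemma isDensity_baseDensity {σ : ℝ} (hσ : 0 < σ) (x₀ : E p) : IsDensity (baseDensity σ x₀) := by
  have h := integral_rescale_mul (mollifier p) (fun _ => 1) hσ x₀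
  simp only [mul_one, integral_mollifier] at h
  refine ⟨fun x => mul_nonneg (by positivity) (mollifier_nonneg _), ?_, h⟩
  -- The integral of a non-integrable function is `0` by convention, so a nonzero integral yields
  -- integrability.
  exact Integrable.of_integral_ne_zero (h.trans_ne one_ne_zero)

lemma baseDensity_eq {σ : ℝ} (hσ : 0 < σ) {x₀ x : E p} (hx : ‖x - x₀‖ ≤ σ) :
    baseDensity σ x₀ x = (σ ^ p)⁻¹ * mollifier p 0 := by
  rw [baseDensity, mollifier_eq_of_norm_le]
  rw [norm_smul, Real.norm_eq_abs, abs_of_pos (inv_pos.2 hσ), inv_mul_le_iff₀ hσ, mul_one]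
  exact hx

lemma exists_baseDensity_isHolder (hp : 1 ≤ p) {s L s' L' : ℝ} (hs : 0 < s) (hL : 0 < L)
    (hs' : 0 < s') (hL' : 0 < L') : ∃ σ : ℝ, 3 ≤ σ ∧ ∀ x₀ : E p,
      IsHolder s (L / 2) (baseDensity σ x₀) ∧ IsHolder s' (L' / 2) (baseDensity σ x₀) := by
  obtain ⟨M, hM0, hM⟩ := exists_isHolder_of_hasCompactSupport (contDiff_mollifier (p := p))
    hasCompactSupport_mollifier hs
  obtain ⟨M', hM0', hM'⟩ := exists_isHolder_of_hasCompactSupport (contDiff_mollifier (p := p))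
    hasCompactSupport_mollifier hs'
  have h1 : 0 < 2 * M / L := by positivity
  have h2 : 0 < 2 * M' / L' := by positivity
  -- Flattening lowers the Hölder constants to half of those allowed, leaving the other half for the
  -- perturbation. The `3` makes the plateau contain the ball of radius `3 * h` for every `h ≤ 1`.
  refine ⟨3 + 2 * M / L + 2 * M' / L', by linarith, fun x₀ => ?_⟩
  set σ := 3 + 2 * M / L + 2 * M' / L'
  have hσ : 0 < σ := by positivity
  have hσ1 : 1 ≤ σ := by simp only [σ]; linarith
  have key : ∀ t N K : ℝ, 0 < t → 0 < N → 0 < K → 2 * N / K ≤ σ →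
      |(σ ^ p)⁻¹| * σ ^ (-t) * N ≤ K / 2 := by
    intro t N K ht hN hK hle
    have e1 : |(σ ^ p)⁻¹| ≤ σ⁻¹ := by
      rw [abs_of_pos (by positivity)]
      exact inv_anti₀ hσ (le_self_pow₀ hσ1 (by omega))
    have e2 : σ ^ (-t) ≤ 1 := Real.rpow_le_one_of_one_le_of_nonpos hσ1 (by linarith)
    calc _ ≤ σ⁻¹ * 1 * N := by gcongr
      _ ≤ K / 2 := by
        rw [mul_one, inv_mul_le_iff₀ hσ]
        rw [div_le_iff₀ hK] at hle
        linarith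
  exact ⟨(hM.scale _ hσ x₀).mono (key s M L hs hM0 hL (by simp only [σ]; linarith)),
    (hM'.scale _ hσ x₀).mono (key s' M' L' hs' hM0' hL' (by simp only [σ]; linarith))⟩

end Base

/-! ### The perturbed density and its transport to the base density -/

section Perturbation

/-- The relative density of the perturbed law. -/
noncomputable def tilt (i : Fin p) (κ h : ℝ) (x₀ x : E p) : ℝ :=
  1 + κ * waveDeriv i (h⁻¹ • (x - x₀))

/-- The map which transports the perturbed law to the base law. -/
noncomputable def transport (i : Fin p) (κ h : ℝ) (x₀ x : E p) : E p :=
  x + (κ * h * wave i (h⁻¹ • (x - x₀))) • EuclideanSpace.single i 1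

lemma continuous_tilt (i : Fin p) (κ h : ℝ) (x₀ : E p) : Continuous (tilt i κ h x₀) := by
  have := (contDiff_waveDeriv i).continuous
  unfold tilt
  fun_prop

lemma continuous_transport (i : Fin p) (κ h : ℝ) (x₀ : E p) :
    Continuous (transport i κ h x₀) := by
  have := (contDiff_wave i).continuous
  unfold transport
  fun_prop

lemma norm_inv_smul {h : ℝ} (hh : 0 < h) (x : E p) : ‖h⁻¹ • x‖ = ‖x‖ / h := by
  rw [norm_smul, Real.norm_eq_abs, abs_of_pos (inv_pos.2 hh), inv_mul_eq_div]

lemma transport_eq_self (i : Fin p) (κ : ℝ) {h : ℝ} (hh : 0 < h) {x₀ x : E p}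
    (hx : 2 * h < ‖x - x₀‖) : transport i κ h x₀ x = x := by
  rw [transport, wave_eq_zero]
  · simp
  · rw [norm_inv_smul hh, le_div_iff₀ hh]; exact hx.le

lemma tilt_eq_one (i : Fin p) (κ : ℝ) {h : ℝ} (hh : 0 < h) {x₀ x : E p}
    (hx : 2 * h < ‖x - x₀‖) : tilt i κ h x₀ x = 1 := by
  rw [tilt, waveDeriv_eq_zero]
  · simp
  · rw [norm_inv_smul hh, lt_div_iff₀ hh]; exact hx

/-- The Jacobian of the shear is exactly `tilt`, and the base density is unchanged along the motion,
so the change of variables formula is the claim. -/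
lemma map_transport_law {i : Fin p} {κ h Λ B σ : ℝ} (x₀ : E p) (hκ : 0 ≤ κ) (hh : 0 < h)
    (hΛ : ∀ x y, |wave i x - wave i y| ≤ Λ * ‖x - y‖) (hΛ' : ∀ x, |waveDeriv i x| ≤ Λ)
    (hB : ∀ x, |wave i x| ≤ B) (hκΛ : κ * Λ ≤ 1 / 2) (hκB : κ * B ≤ 1) (hσ : 3 * h ≤ σ) :
    (law fun x => baseDensity σ x₀ x * tilt i κ h x₀ x).map (transport i κ h x₀)
      = law (baseDensity σ x₀) := by
  have hσ0 : 0 < σ := by linarith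
  have hS := continuous_transport i κ h x₀
  have hf := (contDiff_baseDensity σ x₀).continuous
  have hz := continuous_tilt i κ h x₀
  set w : E p → ℝ := fun x => κ * h * wave i (h⁻¹ • (x - x₀))
  have hinner : ∀ x, HasFDerivAt (fun x : E p => h⁻¹ • (x - x₀))
      (h⁻¹ • ContinuousLinearMap.id ℝ (E p)) x := fun x =>
    ((hasFDerivAt_id x).sub_const x₀).const_smul h⁻¹
  have hwd : ∀ x, HasFDerivAt w ((κ * h) • (fderiv ℝ (wave i) (h⁻¹ • (x - x₀))).comp
      (h⁻¹ • ContinuousLinearMap.id ℝ (E p))) x := fun x =>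
    ((((contDiff_wave i).differentiable (by simp)) _).hasFDerivAt.comp x (hinner x)).const_mul
      (κ * h)
  have hfd : ∀ x, 1 + fderiv ℝ w x (EuclideanSpace.single i 1) = tilt i κ h x₀ x := by
    intro x
    rw [(hwd x).fderiv, tilt, waveDeriv]
    simp only [smul_apply, ContinuousLinearMap.comp_apply,
      ContinuousLinearMap.id_apply, map_smul, smul_eq_mul]
    field_simp
  have htilt : ∀ x, 0 ≤ tilt i κ h x₀ x := by
    intro x
    have h1 : |κ * waveDeriv i (h⁻¹ • (x - x₀))| ≤ 1 / 2 := by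
      rw [abs_mul, abs_of_nonneg hκ]
      exact (mul_le_mul_of_nonneg_left (hΛ' _) hκ).trans hκΛ
    have := (abs_le.1 h1).1
    rw [tilt]; linarith
  have hwL : ∀ x y, |w x - w y| ≤ 1 / 2 * ‖x - y‖ := by
    intro x y
    have h1 := hΛ (h⁻¹ • (x - x₀)) (h⁻¹ • (y - x₀))
    rw [← smul_sub, sub_sub_sub_cancel_right, norm_inv_smul hh] at h1
    calc |w x - w y| = κ * h * |wave i (h⁻¹ • (x - x₀)) - wave i (h⁻¹ • (y - x₀))| := by
          rw [← mul_sub, abs_mul, abs_of_nonneg (by positivity)]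
      _ ≤ κ * h * (Λ * (‖x - y‖ / h)) := by gcongr
      _ = κ * Λ * ‖x - y‖ := by field_simp
      _ ≤ _ := by gcongr
  -- Points farther than `2 * h` from `x₀` are fixed; the others move by at most `h` and stay on the
  -- plateau, since `3 * h ≤ σ`.
  have hbase : ∀ x, baseDensity σ x₀ (transport i κ h x₀ x) = baseDensity σ x₀ x := by
    intro x
    rcases lt_or_ge (2 * h) ‖x - x₀‖ with hx | hx
    · rw [transport_eq_self i κ hh hx]
    · rw [baseDensity_eq hσ0 (x := x) (by linarith), baseDensity_eq hσ0]
      have h1 : transport i κ h x₀ x - x₀ = (x - x₀) + w x • EuclideanSpace.single i 1 := by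
        rw [transport]; abel
      have h2 : |w x| ≤ h := by
        rw [abs_mul, abs_of_nonneg (by positivity)]
        calc κ * h * |wave i (h⁻¹ • (x - x₀))| ≤ κ * h * B := by gcongr; exact hB _
          _ = (κ * B) * h := by ring
          _ ≤ 1 * h := by gcongr
          _ = h := one_mul h
      rw [h1]
      refine (norm_add_le _ _).trans ?_
      rw [norm_smul, PiLp.norm_single, norm_one, mul_one, Real.norm_eq_abs]
      linarith
  ext A hA
  rw [Measure.map_apply hS.measurable hA, law, law, withDensity_apply _ (hS.measurable hA),
    withDensity_apply _ hA, ← lintegral_indicator hA, ← lintegral_indicator (hS.measurable hA),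
    lintegral_shear (w := w) (fun x => (hwd x).differentiableAt) hwL
      (e := EuclideanSpace.single i 1) (by simp)
      (A.indicator fun x => ENNReal.ofReal (baseDensity σ x₀ x))]
  refine lintegral_congr fun x => ?_
  rw [hfd, abs_of_nonneg (htilt x)]
  change _ = _ * A.indicator (fun x => ENNReal.ofReal (baseDensity σ x₀ x)) (transport i κ h x₀ x)
  by_cases hx : transport i κ h x₀ x ∈ A
  · rw [Set.indicator_of_mem hx, Set.indicator_of_mem (show x ∈ _ ⁻¹' A from hx), hbase, mul_comm,
      ENNReal.ofReal_mul (htilt x)]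
  · rw [Set.indicator_of_notMem hx, Set.indicator_of_notMem (show x ∉ _ ⁻¹' A from hx), mul_zero]

end Perturbation

end WassersteinDensity

namespace WassersteinDensity

variable {p : ℕ}

/-! ### The lower bound -/

section LowerBound

lemma law_mul {f z : E p → ℝ} (hf : Continuous f) (hz : Continuous z) (hf0 : ∀ x, 0 ≤ f x) :
    law (fun x => f x * z x) = (law f).withDensity fun x => ENNReal.ofReal (z x) := by
  rw [law, law, ← withDensity_mul _ (by fun_prop) (by fun_prop)]
  congr 1
  ext x
  rw [ENNReal.ofReal_mul (hf0 x)]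
  rfl

lemma ellNorm_zero {q : ℝ≥0∞} (hq : 1 ≤ q) : ellNorm q (0 : E p) = 0 := by
  have : Fact (1 ≤ q) := ⟨hq⟩
  rw [ellNorm_eq, map_zero, norm_zero]

/-- The coupling `(S x, x)` costs at most `c^r` on `A` and nothing elsewhere. -/
lemma wasserstein_map_le {q : ℝ≥0∞} (hq : 1 ≤ q) {r : ℝ} (hr : 1 ≤ r) {ν : Measure (E p)}
    {S : E p → E p} (hS : Measurable S) {A : Set (E p)} (hA : MeasurableSet A) {c m : ℝ}
    (hc : 0 ≤ c) (hm : 0 ≤ m) (hSA : ∀ x, x ∉ A → S x = x) (hSc : ∀ x, ellNorm q (S x - x) ≤ c)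
    (hν : ν A ≤ ENNReal.ofReal m) :
    wasserstein q r (ν.map S) ν ≤ ENNReal.ofReal (c * m ^ (1 / r)) := by
  have hr0 : 0 < r := one_pos.trans_le hr
  have hm' : Measurable fun x : E p => (S x, x) := by fun_prop
  have hcont := continuous_ellNorm (p := p) hq
  have h0 : ellNorm q (0 : E p) = 0 := ellNorm_zero hq
  have hmeas : Measurable fun z : E p × E p => ENNReal.ofReal (ellNorm q (z.1 - z.2) ^ r) := by
    fun_prop
  have hcost : ∫⁻ z, ENNReal.ofReal (ellNorm q (z.1 - z.2) ^ r) ∂(ν.map fun x => (S x, x))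
      ≤ ENNReal.ofReal (c ^ r * m) := by
    calc _ = ∫⁻ x, ENNReal.ofReal (ellNorm q (S x - x) ^ r) ∂ν := by
          rw [lintegral_map hmeas hm']
      _ ≤ ∫⁻ x, A.indicator (fun _ => ENNReal.ofReal (c ^ r)) x ∂ν := by
          refine lintegral_mono fun x => ?_
          by_cases hx : x ∈ A
          · simp only [Set.indicator_of_mem hx]
            exact ENNReal.ofReal_le_ofReal
              (Real.rpow_le_rpow (ellNorm_nonneg hq _) (hSc x) hr0.le)
          · simp [hx, hSA x hx, h0, Real.zero_rpow hr0.ne']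
      _ = ENNReal.ofReal (c ^ r) * ν A := by
          rw [lintegral_indicator hA, setLIntegral_const]
      _ ≤ _ := by
          rw [ENNReal.ofReal_mul (by positivity)]
          gcongr
  have hcoup : IsCoupling (ν.map fun x => (S x, x)) (ν.map S) ν := by
    refine ⟨?_, ?_⟩
    · rw [Measure.map_map measurable_fst hm']; rfl
    · rw [Measure.map_map measurable_snd hm']; exact Measure.map_id
  rw [wasserstein]
  refine (ENNReal.rpow_le_rpow (iInf₂_le_of_le (ν.map fun x => (S x, x)) hcoup hcost)
    (by positivity)).trans (le_of_eq ?_)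
  rw [ENNReal.ofReal_rpow_of_nonneg (by positivity) (by positivity),
    Real.mul_rpow (by positivity) hm, ← Real.rpow_mul hc, mul_one_div_cancel hr0.ne', Real.rpow_one]

lemma wasserstein_self {q : ℝ≥0∞} (hq : 1 ≤ q) {r : ℝ} (hr : 1 ≤ r) (μ : Measure (E p)) :
    wasserstein q r μ μ = 0 := by
  have h0 : ellNorm q (0 : E p) = 0 := ellNorm_zero hq
  have h := wasserstein_map_le hq hr (ν := μ) measurable_id MeasurableSet.empty le_rfl le_rfl
    (fun _ _ => rfl) (fun x => by simp [h0]) (by simp)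
  simpa using h

/-- A pair of close densities in the Hölder classes, separated at `x₀`. -/
lemma exists_density_pair (hp : 1 ≤ p) {s L s' L' : ℝ} (hs : 0 < s) (hL : 0 < L) (hs' : 0 < s')
    (hss : s' ≤ s) (hL' : 0 < L') {q : ℝ≥0∞} (hq : 1 ≤ q) {r : ℝ} (hr : 1 ≤ r) :
    ∃ γ A : ℝ, 0 < γ ∧ 0 ≤ A ∧ ∀ (x₀ : E p) (h : ℝ), 0 < h → h ≤ 1 → ∃ f z : E p → ℝ,
      IsDensity f ∧ IsHolder s L f ∧ IsHolder s' L' f ∧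
      IsDensity (fun x => f x * z x) ∧ IsHolder s L (fun x => f x * z x) ∧
      IsHolder s' L' (fun x => f x * z x) ∧ Continuous z ∧
      ∫⁻ x, ENNReal.ofReal (z x) ^ 2 ∂(law f) ≤ ENNReal.ofReal (1 + A * h ^ (2 * s + p)) ∧
      wasserstein q r (law f) (law fun x => f x * z x) ≤ ENNReal.ofReal (h ^ (s + 1 + p / r)) ∧
      γ * h ^ s ≤ |f x₀ - f x₀ * z x₀| := by
  have hr0 : 0 < r := one_pos.trans_le hr
  set i : Fin p := ⟨0, hp⟩
  obtain ⟨σ, hσ3, hσ⟩ := exists_baseDensity_isHolder hp hs hL hs' hL'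
  obtain ⟨Λ, B, hΛ0, hB0, hΛ, hΛ', hB⟩ := exists_wave_bounds i
  obtain ⟨Bf, hBf0, hBf⟩ := exists_density_le p hs hL
  obtain ⟨Cq, hCq0, hCq⟩ := exists_ellNorm_le p hq
  obtain ⟨M, hM0, hM⟩ := exists_isHolder_of_hasCompactSupport (contDiff_waveDeriv i)
    (hasCompactSupport_waveDeriv i) hs
  obtain ⟨M', hM0', hM'⟩ := exists_isHolder_of_hasCompactSupport (contDiff_waveDeriv i)
    (hasCompactSupport_waveDeriv i) hs'
  have hσ0 : 0 < σ := by linarith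
  set m := (σ ^ p)⁻¹ * mollifier p 0
  have hm0 : 0 < m := mul_pos (by positivity) mollifier_zero_pos
  set D := Bf * (volume (Metric.ball (0 : E p) 1)).toReal * 2 ^ p
  have hD : 0 ≤ D := by positivity
  -- Each summand is a smallness requirement on `δ`: positivity of `z` and invertibility of the
  -- shear, displacement at most `h`, the two Hölder budgets, and the Wasserstein bound with
  -- constant `1`.
  set K := 2 * Λ + B + 2 * (m * M) / L + 2 * (m * M') / L' + Cq * B * D ^ (1 / r)
  have k1 : 0 ≤ 2 * Λ := by positivity
  have k2 : 0 ≤ 2 * (m * M) / L := by positivity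
  have k3 : 0 ≤ 2 * (m * M') / L' := by positivity
  have k4 : 0 ≤ Cq * B * D ^ (1 / r) := by positivity
  set δ := (1 + K)⁻¹
  have hK : 0 ≤ K := by positivity
  have hδ0 : 0 < δ := by positivity
  have hδ1 : δ ≤ 1 := inv_le_one_of_one_le₀ (by linarith)
  have hδK : ∀ x, x ≤ K → δ * x ≤ 1 := fun x hx => by
    rw [inv_mul_le_iff₀ (by positivity)]; linarith
  refine ⟨m * δ, Λ ^ 2 * D, by positivity, by positivity, fun x₀ h hh hh1 => ?_⟩
  set κ := δ * h ^ s
  have hκ0 : 0 < κ := by positivity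
  have hκδ : κ ≤ δ := mul_le_of_le_one_right hδ0.le (Real.rpow_le_one hh.le hh1 hs.le)
  have hκh : κ ≤ h ^ s := mul_le_of_le_one_left (by positivity) hδ1
  have hκΛ : κ * Λ ≤ 1 / 2 := by
    have h1 := hδK (2 * Λ) (by simp only [K]; linarith)
    have h2 : κ * Λ ≤ δ * Λ := by gcongr
    linarith
  have hκB : κ * B ≤ 1 :=
    (mul_le_mul_of_nonneg_right hκδ hB0).trans (hδK B (by simp only [K]; linarith))
  set f := baseDensity σ x₀
  set z := tilt i κ h x₀
  have hf : IsDensity f := isDensity_baseDensity hσ0 x₀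
  have hfc : Continuous f := (contDiff_baseDensity σ x₀).continuous
  have hzc : Continuous z := continuous_tilt i κ h x₀
  have hψ : ∀ x, |z x - 1| ≤ κ * Λ := fun x => by
    simp only [z, tilt, add_sub_cancel_left, abs_mul, abs_of_pos hκ0]
    gcongr
    exact hΛ' _
  have hz0 : ∀ x, 0 ≤ z x := fun x => by
    have := (abs_le.1 (hψ x)).1
    linarith
  have hfz : (fun x => f x * z x) = fun x => f x + κ * m * waveDeriv i (h⁻¹ • (x - x₀)) := by
    ext x
    rcases lt_or_ge (2 * h) ‖x - x₀‖ with hx | hx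
    · rw [waveDeriv_eq_zero i (by rw [norm_inv_smul hh, lt_div_iff₀ hh]; exact hx)]
      simp [z, tilt_eq_one i κ hh hx]
    · have : f x = m := baseDensity_eq hσ0 (by linarith)
      simp only [z, tilt, this]; ring
  -- The amplitude `h^s` absorbs the loss `h^(-t)` when `t ≤ s`; for the class of the contaminated
  -- density this is where `s' ≤ s` enters.
  have hsmall : ∀ t N Q : ℝ, t ≤ s → 0 < N → 0 < Q → 2 * (m * N) / Q ≤ K →
      |κ * m| * h ^ (-t) * N ≤ Q / 2 := by
    intro t N Q ht hN hQ hle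
    have h1 : h ^ s * h ^ (-t) ≤ 1 := by
      rw [← Real.rpow_add hh]
      exact Real.rpow_le_one hh.le hh1 (by linarith)
    have h2 := hδK _ hle
    rw [abs_of_pos (by positivity)]
    calc κ * m * h ^ (-t) * N = δ * (m * N) * (h ^ s * h ^ (-t)) := by simp only [κ]; ring
      _ ≤ δ * (m * N) * 1 := by gcongr
      _ = δ * (2 * (m * N) / Q) * (Q / 2) := by field_simp
      _ ≤ 1 * (Q / 2) := by gcongr
      _ = Q / 2 := one_mul _
  have hH : IsHolder s L (fun x => f x * z x) := by
    rw [hfz]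
    refine ((hσ x₀).1.add (hM.scale (κ * m) hh x₀)).mono ?_
    have := hsmall s M L le_rfl hM0 hL (by simp only [K]; linarith)
    linarith
  have hH' : IsHolder s' L' (fun x => f x * z x) := by
    rw [hfz]
    refine ((hσ x₀).2.add (hM'.scale (κ * m) hh x₀)).mono ?_
    have := hsmall s' M' L' hss hM0' hL' (by simp only [K]; linarith)
    linarith
  have hprob := hf.isProbabilityMeasure
  have hmap : (law fun x => f x * z x).map (transport i κ h x₀) = law f :=
    map_transport_law x₀ hκ0.le hh hΛ hΛ' hB hκΛ hκB (by linarith)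
  have hS : Measurable (transport i κ h x₀) := (continuous_transport i κ h x₀).measurable
  -- A pushforward preserves total mass, so the perturbed density has mass `1` without integrating
  -- `waveDeriv`.
  have huniv : law (fun x => f x * z x) Set.univ = 1 := by
    have h1 : (law fun x => f x * z x).map (transport i κ h x₀) Set.univ = 1 := by
      rw [hmap, measure_univ]
    rwa [Measure.map_apply hS MeasurableSet.univ, Set.preimage_univ] at h1
  have hfz0 : ∀ x, 0 ≤ f x * z x := fun x => mul_nonneg (hf.1 x) (hz0 x)
  have hfzd : IsDensity (fun x => f x * z x) := by
    have hi : Integrable fun x => f x * z x := by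
      refine hf.2.1.mul_bdd (c := 2) hzc.aestronglyMeasurable
        (Filter.Eventually.of_forall fun x => ?_)
      have := abs_le.1 (hψ x)
      rw [Real.norm_eq_abs, abs_of_nonneg (hz0 x)]
      linarith
    refine ⟨hfz0, hi, ?_⟩
    rw [law, withDensity_apply _ MeasurableSet.univ, Measure.restrict_univ,
      ← ofReal_integral_eq_lintegral_ofReal hi (Filter.Eventually.of_forall hfz0)] at huniv
    exact ENNReal.ofReal_eq_one.1 huniv
  have hHf : IsHolder s L f := (hσ x₀).1.mono (by linarith)
  set S := Metric.closedBall x₀ (2 * h)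
  have hout : ∀ x, x ∉ S → 2 * h < ‖x - x₀‖ := fun x hx => by
    rwa [Metric.mem_closedBall, not_le, dist_eq_norm] at hx
  have hDh : Bf * (volume (Metric.ball (0 : E p) 1)).toReal * (2 * h) ^ p = D * h ^ p := by
    rw [mul_pow]; ring
  refine ⟨f, z, hf, hHf, (hσ x₀).2.mono (by linarith), hfzd, hH, hH', hzc, ?_, ?_, ?_⟩
  · have hmass : law f S ≤ ENNReal.ofReal (D * h ^ p) := by
      rw [← hDh]
      exact law_closedBall_le hBf0.le (hBf f hf hHf) x₀ (by positivity)
    have h1 : ∫⁻ x, ENNReal.ofReal (z x) ∂(law f) = 1 := by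
      rw [← huniv, law_mul hfc hzc hf.1, withDensity_apply _ MeasurableSet.univ,
        Measure.restrict_univ]
    have h2 : ∫⁻ x, ENNReal.ofReal ((z x - 1) ^ 2) ∂(law f)
        ≤ ENNReal.ofReal (Λ ^ 2 * D * h ^ (2 * s + p)) :=
      calc _ ≤ ∫⁻ x, S.indicator (fun _ => ENNReal.ofReal ((κ * Λ) ^ 2)) x ∂(law f) := by
            refine lintegral_mono fun x => ?_
            by_cases hx : x ∈ S
            · simp only [Set.indicator_of_mem hx]
              exact ENNReal.ofReal_le_ofReal (sq_le_sq.2 ((hψ x).trans (le_abs_self _)))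
            · simp [hx, z, tilt_eq_one i κ hh (hout x hx)]
        _ = ENNReal.ofReal ((κ * Λ) ^ 2) * law f S := by
            rw [lintegral_indicator measurableSet_closedBall, setLIntegral_const]
        _ ≤ ENNReal.ofReal ((κ * Λ) ^ 2) * ENNReal.ofReal (D * h ^ p) := by gcongr
        _ = ENNReal.ofReal ((κ * Λ) ^ 2 * (D * h ^ p)) :=
            (ENNReal.ofReal_mul (by positivity)).symm
        _ ≤ _ := by
            refine ENNReal.ofReal_le_ofReal ?_
            have e1 : h ^ (2 * s + p) = (h ^ s) ^ 2 * h ^ p := by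
              rw [Real.rpow_add hh, Real.rpow_natCast, ← Real.rpow_natCast (h ^ s),
                ← Real.rpow_mul hh.le]
              congr 2; push_cast; ring
            rw [e1]
            calc (κ * Λ) ^ 2 * (D * h ^ p) ≤ (h ^ s * Λ) ^ 2 * (D * h ^ p) := by gcongr
              _ = _ := by ring
    -- The second moment is `1` plus the chi-square divergence, written as `z² + 1 = 2z + (z - 1)²`
    -- to avoid subtraction in `ℝ≥0∞`.
    have h3 : ∫⁻ x, ENNReal.ofReal (z x) ^ 2 ∂(law f) + 1
        = 2 + ∫⁻ x, ENNReal.ofReal ((z x - 1) ^ 2) ∂(law f) := by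
      calc _ = ∫⁻ x, (ENNReal.ofReal (z x) ^ 2 + 1) ∂(law f) := by
            rw [lintegral_add_right _ measurable_const]; simp
        _ = ∫⁻ x, (2 * ENNReal.ofReal (z x) + ENNReal.ofReal ((z x - 1) ^ 2)) ∂(law f) := by
            refine lintegral_congr fun x => ?_
            have e2 : (2 : ℝ≥0∞) = ENNReal.ofReal 2 := by simp
            rw [← ENNReal.ofReal_pow (hz0 x), ← ENNReal.ofReal_one,
              ← ENNReal.ofReal_add (sq_nonneg _) zero_le_one, e2,
              ← ENNReal.ofReal_mul zero_le_two,
              ← ENNReal.ofReal_add (mul_nonneg zero_le_two (hz0 x)) (sq_nonneg _)]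
            congr 1; ring
        _ = _ := by
            rw [lintegral_add_left (by fun_prop), lintegral_const_mul _ (by fun_prop), h1, mul_one]
    refine (ENNReal.add_le_add_iff_right ENNReal.one_ne_top).1 (h3.le.trans ?_)
    rw [ENNReal.ofReal_add zero_le_one (by positivity), ENNReal.ofReal_one, add_right_comm,
      one_add_one_eq_two]
    gcongr
  · rw [← hmap]
    have hmass : law (fun x => f x * z x) S ≤ ENNReal.ofReal (D * h ^ p) := by
      rw [← hDh]
      exact law_closedBall_le hBf0.le (hBf _ hfzd hH) x₀ (by positivity)
    have hmove : ∀ x, ellNorm q (transport i κ h x₀ x - x) ≤ Cq * (κ * h * B) := fun x => by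
      refine (hCq _).trans ?_
      gcongr
      rw [transport, add_sub_cancel_left, norm_smul, PiLp.norm_single, norm_one, mul_one,
        Real.norm_eq_abs, abs_mul, abs_of_pos (by positivity)]
      gcongr
      exact hB _
    refine (wasserstein_map_le hq hr hS measurableSet_closedBall (by positivity) (by positivity)
      (fun x hx => transport_eq_self i κ hh (hout x hx)) hmove hmass).trans
      (ENNReal.ofReal_le_ofReal ?_)
    have e1 : h ^ (s + 1 + p / r) = h ^ s * h * (h ^ p) ^ (1 / r) := by
      rw [Real.rpow_add hh, Real.rpow_add hh, Real.rpow_one, ← Real.rpow_natCast h p,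
        ← Real.rpow_mul hh.le, mul_one_div]
    have e2 := hδK (Cq * B * D ^ (1 / r)) (by simp only [K]; linarith)
    rw [e1, Real.mul_rpow hD (by positivity)]
    calc _ = δ * (Cq * B * D ^ (1 / r)) * (h ^ s * h * (h ^ p) ^ (1 / r)) := by
          simp only [κ]; ring
      _ ≤ 1 * (h ^ s * h * (h ^ p) ^ (1 / r)) := by gcongr
      _ = _ := one_mul _
  · have e1 : f x₀ = m := baseDensity_eq hσ0 (by simpa using hσ0.le)
    have e2 : z x₀ = 1 + κ := by simp [z, tilt, waveDeriv_zero]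
    rw [e1, e2, show m - m * (1 + κ) = -(m * κ) by ring, abs_neg, abs_of_pos (by positivity)]
    simp only [κ]
    exact le_of_eq (by ring)

lemma risk_le_worstRisk {n : ℕ} {s L s' L' : ℝ} {q : ℝ≥0∞} {r ε : ℝ} {x₀ : E p}
    (T : (Fin n → E p) → ℝ) {f g : E p → ℝ} (h : Admissible s L s' L' q r ε f g) :
    risk x₀ T f g ≤ worstRisk s L s' L' q r ε x₀ T :=
  le_iSup_of_le f (le_iSup_of_le g (le_iSup_of_le h le_rfl))

/-- The minimax lower bound. -/
lemma exists_le_minimaxRisk (hp : 1 ≤ p) {s L s' L' : ℝ} (hs : 0 < s) (hL : 0 < L) (hs' : 0 < s')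
    (hss : s' ≤ s) (hL' : 0 < L') {q : ℝ≥0∞} (hq : 1 ≤ q) {r : ℝ} (hr : 1 ≤ r) :
    ∃ c : ℝ, 0 < c ∧ ∀ (x₀ : E p) (n : ℕ), 1 ≤ n → ∀ ε : ℝ, 0 < ε → ε ≤ 1 →
      ENNReal.ofReal (c * rate p n s r ε) ≤ minimaxRisk n s L s' L' q r ε x₀ := by
  have hr0 : 0 < r := one_pos.trans_le hr
  obtain ⟨γ, A, hγ, hA, hpair⟩ := exists_density_pair hp hs hL hs' hss hL' hq hr
  have hsep : ∀ {a b h : ℝ}, 0 < h → γ * h ^ s ≤ |a - b| → γ ^ 2 * h ^ (2 * s) ≤ (a - b) ^ 2 := by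
    intro a b h hh hab
    have h1 : h ^ (2 * s) = (h ^ s) ^ 2 := by
      rw [← Real.rpow_natCast (h ^ s), ← Real.rpow_mul hh.le]; congr 1; push_cast; ring
    rw [h1, ← mul_pow, ← sq_abs (a - b)]
    gcongr
  -- Chosen so that `(1 + A/n)^n ≤ exp A = a²` bounds the second moment of the `n`-sample likelihood
  -- ratio; the same `a` serves in both regimes.
  set a := Real.exp (A / 2)
  have ha1 : 1 ≤ a := Real.one_le_exp (by positivity)
  refine ⟨γ ^ 2 / (a + 1) ^ 2, by positivity, fun x₀ n hn ε hε hε1 =>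
    le_iInf₂ fun T hT => ?_⟩
  have hn0 : (0 : ℝ) < n := by exact_mod_cast hn
  have hn1 : (1 : ℝ) ≤ n := by exact_mod_cast hn
  rw [rate, mul_max_of_nonneg _ _ (by positivity), ENNReal.ofReal_max]
  refine max_le ?_ ?_
  · set h := (n : ℝ) ^ (-1 / (2 * s + (p : ℝ)))
    have he : 0 < 2 * s + p := by positivity
    have hh : 0 < h := Real.rpow_pos_of_pos hn0 _
    have hh1 : h ≤ 1 := Real.rpow_le_one_of_one_le_of_nonpos hn1
      (div_nonpos_of_nonpos_of_nonneg (by norm_num) he.le)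
    obtain ⟨f, z, hf, hfs, hfs', hg, hgs, hgs', hz, hz2, -, hx⟩ := hpair x₀ h hh hh1
    have hhn : h ^ (2 * s + p) = (n : ℝ)⁻¹ := by
      rw [← Real.rpow_mul hn0.le, div_mul_cancel₀ _ he.ne', Real.rpow_neg_one]
    have hhs : h ^ (2 * s) = (n : ℝ) ^ (-(2 * s) / (2 * s + (p : ℝ))) := by
      rw [← Real.rpow_mul hn0.le]; congr 1; ring
    have := hf.isProbabilityMeasure
    have hgp := hg.isProbabilityMeasure
    have hfc : Continuous f := hfs.1.continuous
    have hlaw := law_mul hfc hz hf.1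
    rw [hlaw] at hgp
    have hzm : Measurable fun x => ENNReal.ofReal (z x) := by fun_prop
    have hpi := pi_withDensity (n := n) (law f) hzm
    have hZ : Measurable fun X : Fin n → E p => ∏ i, ENNReal.ofReal (z (X i)) := by fun_prop
    have hprob : IsProbabilityMeasure ((Measure.pi fun _ : Fin n => law f).withDensity
        fun X => ∏ i, ENNReal.ofReal (z (X i))) := by
      rw [← hpi]; infer_instance
    -- Here the data are uncontaminated: each density is paired with itself.
    have hR := fun {u : E p → ℝ} (hu : IsDensity u) (hus : IsHolder s L u)
      (hus' : IsHolder s' L' u) => risk_le_worstRisk (n := n) (x₀ := x₀) T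
        (⟨hu, hus, hu, hus', by rw [wasserstein_self hq hr]; exact zero_le⟩ :
          Admissible s L s' L' q r ε u u)
    have hR1 := hR hg hgs hgs'
    rw [risk, hlaw, hpi] at hR1
    refine le_trans (ENNReal.ofReal_le_ofReal ?_) (two_point_bound _ hZ hT (A := a)
      (by positivity) ?_ (hR hf hfs hfs') hR1)
    · rw [div_mul_eq_mul_div, ← hhs]
      gcongr
      exact hsep hh hx
    · simp_rw [← Finset.prod_pow]
      rw [lintegral_prod_pi (law f) (z := fun _ x => ENNReal.ofReal (z x) ^ 2)
        fun _ => hzm.pow_const 2, Finset.prod_const, Finset.card_univ, Fintype.card_fin]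
      calc _ ≤ ENNReal.ofReal (1 + A * h ^ (2 * s + p)) ^ n := by gcongr
        _ = ENNReal.ofReal ((1 + A * h ^ (2 * s + p)) ^ n) :=
            (ENNReal.ofReal_pow (by positivity) n).symm
        _ ≤ _ := by
            refine ENNReal.ofReal_le_ofReal ?_
            rw [hhn]
            calc (1 + A * (n : ℝ)⁻¹) ^ n ≤ Real.exp (A * (n : ℝ)⁻¹) ^ n := by
                  gcongr
                  rw [add_comm]
                  exact Real.add_one_le_exp _
              _ = a ^ 2 := by
                  rw [← Real.exp_nat_mul, ← Real.exp_nat_mul]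
                  congr 1
                  field_simp
                  push_cast; ring
  · set h := ε ^ (1 / (s + 1 + (p : ℝ) / r))
    have he : 0 < s + 1 + p / r := by positivity
    have hh : 0 < h := Real.rpow_pos_of_pos hε _
    have hh1 : h ≤ 1 := Real.rpow_le_one hε.le hε1 (by positivity)
    obtain ⟨f, z, hf, hfs, hfs', hg, hgs, hgs', hz, -, hW, hx⟩ := hpair x₀ h hh hh1
    have hhε : h ^ (s + 1 + p / r) = ε := by
      rw [← Real.rpow_mul hε.le, div_mul_cancel₀ _ he.ne', Real.rpow_one]
    have hhs : h ^ (2 * s) = ε ^ ((2 * s) / (s + 1 + (p : ℝ) / r)) := by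
      rw [← Real.rpow_mul hε.le]; congr 1; ring
    rw [hhε] at hW
    have := hf.isProbabilityMeasure
    have hprob : IsProbabilityMeasure ((Measure.pi fun _ : Fin n => law f).withDensity 1) := by
      rw [withDensity_one]; infer_instance
    -- Both problems generate data from `f`, so the likelihood ratio is `1`.
    have hR0 := risk_le_worstRisk (n := n) (x₀ := x₀) T
      (⟨hf, hfs, hf, hfs', by rw [wasserstein_self hq hr]; exact zero_le⟩ :
        Admissible s L s' L' q r ε f f)
    have hR1 := risk_le_worstRisk (n := n) (x₀ := x₀) T
      (⟨hg, hgs, hf, hfs', hW⟩ : Admissible s L s' L' q r ε (fun x => f x * z x) f)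
    refine le_trans (ENNReal.ofReal_le_ofReal ?_) (two_point_bound _ measurable_one hT (A := 1)
      zero_le_one ?_ hR0 (by rw [withDensity_one]; exact hR1))
    · rw [div_mul_eq_mul_div, ← hhs]
      gcongr
      exact hsep hh hx
    · simp

end LowerBound

end WassersteinDensity

theorem theorem1 (p : ℕ) (hp : 1 ≤ p) (s : ℝ) (hs : 0 < s) :
    ∃ K : E p → ℝ,
      (ContDiff ℝ ∞ K ∧ HasCompactSupport K ∧ (∃ B : ℝ, ∀ x, |K x| ≤ B) ∧ ∫ x, K x = 1) ∧
      ∀ (L : ℝ) (_ : 0 < L) (s' : ℝ) (_ : 0 < s') (_ : s' ≤ s) (L' : ℝ) (_ : 0 < L')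
        (q : ℝ≥0∞) (_ : 1 ≤ q) (r : ℝ) (_ : 1 ≤ r),
        (∃ c C : ℝ, 0 < c ∧ 0 < C ∧
          ∀ (x₀ : E p) (n : ℕ) (_ : 1 ≤ n) (ε : ℝ) (_ : 0 < ε) (_ : ε ≤ 1),
            ENNReal.ofReal (c * rate p n s r ε) ≤ minimaxRisk n s L s' L' q r ε x₀ ∧
            minimaxRisk n s L s' L' q r ε x₀ ≤ ENNReal.ofReal (C * rate p n s r ε)) ∧
        (∀ (a b : ℝ) (_ : 0 < a) (_ : a ≤ b), ∃ C : ℝ, 0 < C ∧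
          ∀ (x₀ : E p) (n : ℕ) (_ : 1 ≤ n) (ε : ℝ) (_ : 0 < ε) (_ : ε ≤ 1) (h : ℝ)
            (_ : a * bandwidth p n s r ε ≤ h) (_ : h ≤ b * bandwidth p n s r ε),
            worstRisk s L s' L' q r ε x₀ (kde (n := n) K h x₀)
              ≤ ENNReal.ofReal (C * rate p n s r ε)) := by
  refine ⟨higherOrderKernel p (holderOrder s), ⟨contDiff_higherOrderKernel _,
    hasCompactSupport_higherOrderKernel _, ?_, integral_higherOrderKernel _⟩,
    fun L hL s' hs' hss L' hL' q hq r hr => ⟨?_, fun a b ha hab => ?_⟩⟩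
  · obtain ⟨B, -, hB⟩ := exists_abs_higherOrderKernel_le p (holderOrder s)
    exact ⟨B, hB⟩
  · obtain ⟨c, hc, hlow⟩ := exists_le_minimaxRisk hp hs hL hs' hss hL' hq hr
    obtain ⟨C, hC, hup⟩ := exists_kde_worstRisk_le p hs hL hs' hL' hq hr one_pos le_rfl
    refine ⟨c, C, hc, hC, fun x₀ n hn ε hε hε1 => ⟨hlow x₀ n hn ε hε hε1, ?_⟩⟩
    have hK := (contDiff_higherOrderKernel (p := p) (holderOrder s)).continuous.measurable
    exact (iInf₂_le _ (measurable_kde hK _ _)).trans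
      (hup x₀ n hn ε hε _ (one_mul _).le (one_mul _).ge)
  · obtain ⟨C, hC, hup⟩ := exists_kde_worstRisk_le p hs hL hs' hL' hq hr ha hab
    exact ⟨C, hC, fun x₀ n hn ε hε _ h h1 h2 => hup x₀ n hn ε hε h h1 h2⟩
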